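/- Let $\langle x\rangle=(1+x^2)^{1/2}$ and let $\widehat H^1=\{u\in H^1(\mathbb R;\mathbb C):\langle x\rangle u\in L^2(\mathbb R)\}$ with norm $\|u\|_{\widehat H^1}^2=\|u\|_{L^2}^2+\|\partial_xu\|_{L^2}^2+\|\langle x\rangle u\|_{L^2}^2$. Let $\widehat H^{-1}$ be the topological dual of $\widehat H^1$, with the embedding $\widehat H^1\subset\widehat H^{-1}$ given by $u\mapsto(\varphi\mapsto\int_{\mathbb R}u\varphi\,dx)$. Fix an integer $p\ge1$ and a sign $\sigma\in\{1,-1\}$. For a real-valued potential $V$ and $u^{(0)}\in\widehat H^1$ consider $$\text{(NLS)}\qquad i\partial_tu=-\partial_{xx}u+x^2u+Vu+\sigma|u|^{2p}u,\qquad u|_{t=0}=u^{(0)},$$ the equation being understood as an identity in $\widehat H^{-1}$ for every $t\in\mathbb R$, and put $$H_V(u)=\frac12\int_{\mathbb R}\bigl(|\partial_xu|^2+x^2|u|^2+V|u|^2\bigr)dx+\frac{\sigma}{2p+2}\int_{\mathbb R}|u|^{2p+2}dx .$$ **Theorem (global well-posedness).** For every $\rho>0$ there are constants $\varepsilon_\rho>0$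 and $C_\rho>0$ (depending only on $\rho$, $p$, $\sigma$) such that: 1. for every real-valued measurable $V$ with $\|V\|_{L^\infty}\le\rho$ and every $u\in\widehat H^1$ with $\|u\|_{\widehat H^1}\le C_\rho\varepsilon_\rho$, $$C_\rho^{-1}\|u\|_{\widehat H^1}^2\le H_V(u)+\rho\|u\|_{L^2}^2\le C_\rho\|u\|_{\widehat H^1}^2;$$ 2. for every real-valued $V\in\widehat H^1$ with $\|V\|_{\widehat H^1}\le\rho$ and every $u^{(0)}\in\widehat H^1$ with $\varepsilon:=\|u^{(0)}\|_{\widehat H^1}\le\varepsilon_\rho$, (NLS) has a unique global solution $u\in C_b^0(\mathbb R,\widehat H^1)\cap C^1(\mathbb R,\widehat H^{-1})$, and this solution satisfies $\|u(t)\|_{\widehat H^1}\le C_\rho\,\varepsilon$ for all $t\in\mathbb R$. -/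

import Mathlib

open MeasureTheory
open scoped ContDiff BoundedContinuousFunction

noncomputable section

namespace HarmonicNLS

/-- The complex Hilbert space `L²(ℝ) = L²(ℝ; ℂ)`. -/
abbrev L2 : Type := Lp ℂ 2 (volume : Measure ℝ)

/-- The Japanese bracket `⟨x⟩ = (1 + x²)^{1/2}`. -/
def bracket (x : ℝ) : ℝ := Real.sqrt (1 + x ^ 2)

/-- `v` is the weak derivative of `u`: `∫ φ' u = - ∫ φ v` for every real test function
`φ ∈ C_c^∞(ℝ)`. -/
def HasWeakDeriv (u v : L2) : Prop :=
  ∀ φ : ℝ → ℝ, ContDiff ℝ ∞ φ → HasCompactSupport φ →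
    ∫ x, deriv φ x • u x = -∫ x, φ x • v x

theorem integrable_test_smul {φ : ℝ → ℝ} (hφ : Continuous φ) (hc : HasCompactSupport φ)
    (u : L2) : Integrable fun x => φ x • u x := by
  have hu : LocallyIntegrable (u : ℝ → ℂ) volume :=
    (Lp.memLp u).locallyIntegrable (by norm_num)
  exact hu.integrable_smul_left_of_hasCompactSupport hφ hc

theorem HasWeakDeriv.zero : HasWeakDeriv 0 0 := by
  intro φ _ _
  have h : ∀ ψ : ℝ → ℝ, ∫ x, ψ x • (0 : L2) x = 0 := by
    intro ψ
    rw [integral_congr_ae (g := fun _ => (0 : ℂ)), integral_zero]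
    filter_upwards with x
    simp
  rw [h, h, neg_zero]

theorem HasWeakDeriv.add {u₁ v₁ u₂ v₂ : L2} (h₁ : HasWeakDeriv u₁ v₁)
    (h₂ : HasWeakDeriv u₂ v₂) : HasWeakDeriv (u₁ + u₂) (v₁ + v₂) := by
  intro φ hφ hc
  have h : ∀ ψ : ℝ → ℝ, Continuous ψ → HasCompactSupport ψ → ∀ a b : L2,
      ∫ x, ψ x • (a + b) x = (∫ x, ψ x • a x) + ∫ x, ψ x • b x := by
    intro ψ hψ hcψ a b
    rw [← integral_add (integrable_test_smul hψ hcψ a) (integrable_test_smul hψ hcψ b)]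
    refine integral_congr_ae ?_
    filter_upwards [Lp.coeFn_add a b] with x hx
    rw [hx, Pi.add_apply, smul_add]
  rw [h _ (hφ.continuous_deriv (by simp)) hc.deriv, h _ hφ.continuous hc, h₁ φ hφ hc,
    h₂ φ hφ hc, neg_add]

theorem HasWeakDeriv.smul (c : ℂ) {u v : L2} (h₁ : HasWeakDeriv u v) :
    HasWeakDeriv (c • u) (c • v) := by
  intro φ hφ hc
  have h : ∀ (ψ : ℝ → ℝ) (a : L2), ∫ x, ψ x • (c • a) x = c * ∫ x, ψ x • a x := by
    intro ψ a
    rw [← integral_const_mul]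
    refine integral_congr_ae ?_
    filter_upwards [Lp.coeFn_smul c a] with x hx
    rw [hx, Pi.smul_apply, smul_comm, smul_eq_mul]
  rw [h, h, h₁ φ hφ hc, mul_neg]

/-- The space `Ĥ¹ = {u ∈ H¹(ℝ) : ⟨x⟩ u ∈ L²(ℝ)}`. An element is stored together with its weak
derivative and its weighted version, as the triple `(u, u', ⟨x⟩ u)` in `L² × L² × L²` (both are
determined by `u`). The norm inherited from the Hilbert sum is the norm of `Ĥ¹`:
`‖u‖² = ‖u‖²_{L²} + ‖u'‖²_{L²} + ‖⟨x⟩ u‖²_{L²} = ‖u‖²_{H¹} + ‖⟨x⟩ u‖²_{L²}`. -/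
def Hhat1 : Submodule ℂ (PiLp 2 fun _ : Fin 3 => L2) where
  carrier := {w | HasWeakDeriv (w 0) (w 1) ∧ ∀ᵐ x : ℝ, w 2 x = (bracket x : ℂ) * w 0 x}
  zero_mem' := by
    refine ⟨HasWeakDeriv.zero, ?_⟩
    filter_upwards with x
    simp
  add_mem' := by
    rintro a b ⟨ha, ha'⟩ ⟨hb, hb'⟩
    refine ⟨ha.add hb, ?_⟩
    filter_upwards [ha', hb', Lp.coeFn_add (a 0) (b 0), Lp.coeFn_add (a 2) (b 2)]
      with x h₁ h₂ h₃ h₄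
    rw [PiLp.add_apply, PiLp.add_apply, h₃, h₄, Pi.add_apply, Pi.add_apply, h₁, h₂, mul_add]
  smul_mem' := by
    rintro c a ⟨ha, ha'⟩
    refine ⟨ha.smul c, ?_⟩
    filter_upwards [ha', Lp.coeFn_smul c (a 0), Lp.coeFn_smul c (a 2)] with x h₁ h₂ h₃
    rw [PiLp.smul_apply, PiLp.smul_apply, h₂, h₃, Pi.smul_apply, Pi.smul_apply, h₁,
      smul_eq_mul, smul_eq_mul, mul_left_comm]

/-- The underlying function: the continuous linear inclusion `Ĥ¹ ⊂ L²`. -/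
def fn : Hhat1 →L[ℂ] L2 :=
  (PiLp.proj 2 (fun _ : Fin 3 => L2) (0 : Fin 3)).comp Hhat1.subtypeL

/-- The weak derivative `u ↦ ∂ₓu`, from `Ĥ¹` to `L²`. -/
def dx : Hhat1 →L[ℂ] L2 :=
  (PiLp.proj 2 (fun _ : Fin 3 => L2) (1 : Fin 3)).comp Hhat1.subtypeL

/-- The space `Ĥ⁻¹`, the topological dual of `Ĥ¹`, with the dual norm. -/
abbrev HhatNeg1 : Type := StrongDual ℂ Hhat1

/-- The inclusion `Ĥ¹ ⊂ Ĥ⁻¹` (with `L²` as pivot space): the function `u` is identified with the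
functional `φ ↦ ∫ u φ dx`. -/
def toHhatNeg1 : Hhat1 →L[ℂ] HhatNeg1 :=
  ((ContinuousLinearMap.mul ℂ ℂ).lpPairing (volume : Measure ℝ) 2 2).bilinearComp fn fn

theorem toHhatNeg1_apply (u φ : Hhat1) : toHhatNeg1 u φ = ∫ x, fn u x * fn φ x :=
  ContinuousLinearMap.lpPairing_eq_integral _ _ _

theorem norm_sq_Hhat1 (u : Hhat1) :
    ‖u‖ ^ 2 = (∫ x, ‖fn u x‖ ^ 2) + (∫ x, ‖dx u x‖ ^ 2) +
      ∫ x, ‖(bracket x : ℂ) * fn u x‖ ^ 2 := by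
  have key : ∀ f : L2, ‖f‖ ^ 2 = ∫ x, ‖f x‖ ^ 2 := by
    intro f
    have h2 : (inner ℂ f f : ℂ) = ((‖f‖ ^ 2 : ℝ) : ℂ) := by
      rw [inner_self_eq_norm_sq_to_K]; norm_cast
    rw [L2.inner_def] at h2
    have h3 : (∫ x, (inner ℂ (f x) (f x) : ℂ)) = ((∫ x, ‖f x‖ ^ 2 : ℝ) : ℂ) := by
      rw [← integral_complex_ofReal]
      refine integral_congr_ae (Filter.Eventually.of_forall fun x => ?_)
      simp only [inner_self_eq_norm_sq_to_K]
      norm_cast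
    rw [h3] at h2
    exact_mod_cast h2.symm
  have h0 : ‖u‖ ^ 2 = ‖u.1 0‖ ^ 2 + ‖u.1 1‖ ^ 2 + ‖u.1 2‖ ^ 2 := by
    change ‖u.1‖ ^ 2 = _
    rw [PiLp.norm_sq_eq_of_L2, Fin.sum_univ_three]
  rw [h0, key, key, key]
  congr 1
  refine integral_congr_ae ?_
  filter_upwards [u.2.2] with x hx
  rw [hx]; rfl

/-- The Hamiltonian
`H(u) = ½ ∫ (|∂ₓu|² + x²|u|² + V|u|²) dx + σ/(2p+2) ∫ |u|^{2p+2} dx`, `σ = ±1`. -/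
def energy (p : ℕ) (σ : ℝ) (V : ℝ → ℝ) (u : Hhat1) : ℝ :=
  1 / 2 * (∫ x, (‖dx u x‖ ^ 2 + x ^ 2 * ‖fn u x‖ ^ 2 + V x * ‖fn u x‖ ^ 2)) +
    σ / (2 * p + 2) * ∫ x, ‖fn u x‖ ^ (2 * p + 2)

/-- `u ∈ C_b⁰(ℝ, Ĥ¹) ∩ C¹(ℝ, Ĥ⁻¹)` is a global solution of
`i ∂ₜu = -∂ₓₓu + x²u + Vu + σ|u|^{2p}u`, `u(0) = u₀`. The equation is an identity in `Ĥ⁻¹` for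
every `t`, that is, it holds when tested against every `φ ∈ Ĥ¹`, with
`⟨-∂ₓₓu, φ⟩ = ∫ ∂ₓu ∂ₓφ dx`. For `u, φ ∈ Ĥ¹` (hence bounded) and bounded `V` all integrals converge
absolutely. -/
structure IsGlobalSolution (p : ℕ) (σ : ℝ) (V : ℝ → ℝ) (u₀ : Hhat1) (u : ℝ →ᵇ Hhat1) :
    Prop where
  initial : u 0 = u₀
  contDiff : ContDiff ℝ 1 fun t => toHhatNeg1 (u t)
  equation : ∀ (t : ℝ) (φ : Hhat1),
    Complex.I * (deriv (fun s => toHhatNeg1 (u s)) t) φ =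
      (∫ x, dx (u t) x * dx φ x) + (∫ x : ℝ, (x : ℂ) ^ 2 * fn (u t) x * fn φ x) +
        (∫ x, (V x : ℂ) * fn (u t) x * fn φ x) +
        (σ : ℂ) * ∫ x, ((‖fn (u t) x‖ ^ (2 * p) : ℝ) : ℂ) * fn (u t) x * fn φ x

end HarmonicNLS

end

/-!
The norm of `Ĥ¹` is the energy norm of `-∂ₓₓ + x² + 2`, so this operator is, up to conjugation, the
Riesz isomorphism `Ĥ¹ → Ĥ⁻¹`, and its inverse restricts to the bounded injective self-adjoint
operator `A = J*J` of `Ĥ¹`, where `J` is the inclusion `Ĥ¹ ⊂ L²`. With `G(u) = Vu - 2u + σ|u|^{2p}u`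
the equation reads `(A u)' = -i (u + A G(u))`. Since `Ĥ¹` is an algebra, `G` is Lipschitz on bounded
sets of `Ĥ¹`; truncating it outside a ball, and passing to the interaction picture with the unitary
group generated by `A⁻¹`, turns the equation into an ordinary differential equation with a bounded
Lipschitz vector field, which has global solutions.

As long as the solution stays in the ball it conserves the mass and the Hamiltonian. Near zero the
term of order `2p + 2` is negligible and `H_V + ρ‖·‖²_{L²}` is comparable to `‖·‖²_{Ĥ¹}`, so a
solution with small data never reaches the boundary of the ball and solves the original equation.
Uniqueness is Grönwall's lemma in `L²`.
-/

noncomputable section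

namespace HarmonicNLS

/-! ### Primitives and weak derivatives -/

section Primitive

variable {E : Type*} [NormedAddCommGroup E]

theorem intervalIntegrable_of_locallyIntegrable {f : ℝ → E} (hf : LocallyIntegrable f volume)
    (a b : ℝ) : IntervalIntegrable f volume a b :=
  intervalIntegrable_iff.mpr <|
    (hf.integrableOn_isCompact isCompact_uIcc).mono_set Set.uIoc_subset_uIcc

theorem absolutelyContinuousOnInterval_of_dist_le {g : ℝ → ℝ} {f : ℝ → E} {a b : ℝ}
    (hg : AbsolutelyContinuousOnInterval g a b) (h : ∀ x y, dist (f x) (f y) ≤ dist (g x) (g y)) :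
    AbsolutelyContinuousOnInterval f a b :=
  squeeze_zero (fun _ => Finset.sum_nonneg fun _ _ => dist_nonneg)
    (fun _ => Finset.sum_le_sum fun _ _ => h _ _) hg

variable [NormedSpace ℝ E]

/-- `f` is a primitive of the locally integrable function `f'`: the fundamental theorem of calculus
holds between any two points. Equivalently, `f` is locally absolutely continuous with derivative
`f'` almost everywhere. -/
structure IsPrimitive (f f' : ℝ → E) : Prop where
  locallyIntegrable : LocallyIntegrable f' volume
  sub_eq : ∀ a b, f b - f a = ∫ x in a..b, f' x

namespace IsPrimitive

variable {f f' : ℝ → E}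

theorem const_add_integral (hf' : LocallyIntegrable f' volume) (c : E) :
    IsPrimitive (fun x => c + ∫ t in (0 : ℝ)..x, f' t) f' := by
  refine ⟨hf', fun a b => ?_⟩
  have h := intervalIntegrable_of_locallyIntegrable hf'
  rw [add_sub_add_left_eq_sub, intervalIntegral.integral_interval_sub_left (h _ _) (h _ _)]

theorem eq_add_integral (hf : IsPrimitive f f') : f = fun x => f 0 + ∫ t in (0 : ℝ)..x, f' t := by
  funext x
  rw [← hf.sub_eq, add_sub_cancel]

theorem of_contDiff [CompleteSpace E] (hf : ContDiff ℝ 1 f) : IsPrimitive f (deriv f) := by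
  have hc : Continuous (deriv f) := hf.continuous_deriv le_rfl
  exact ⟨hc.locallyIntegrable, fun a b => (intervalIntegral.integral_deriv_eq_sub
    (fun x _ => (hf.differentiable one_ne_zero).differentiableAt)
    (hc.intervalIntegrable _ _)).symm⟩

theorem continuous (hf : IsPrimitive f f') : Continuous f := by
  rw [hf.eq_add_integral]
  exact (intervalIntegral.continuous_primitive
    (intervalIntegrable_of_locallyIntegrable hf.locallyIntegrable) 0).const_add _

theorem ae_hasDerivAt [CompleteSpace E] (hf : IsPrimitive f f') :
    ∀ᵐ x, HasDerivAt f (f' x) x := by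
  filter_upwards [_root_.LocallyIntegrable.ae_hasDerivAt_integral hf.locallyIntegrable] with x hx
  rw [hf.eq_add_integral]
  exact (hx 0).const_add _

theorem absolutelyContinuousOnInterval (hf : IsPrimitive f f') (a b : ℝ) :
    AbsolutelyContinuousOnInterval f a b := by
  have hn : LocallyIntegrable (fun x => ‖f' x‖) volume := fun x =>
    (hf.locallyIntegrable x).norm
  have hi := intervalIntegrable_of_locallyIntegrable hn
  refine absolutelyContinuousOnInterval_of_dist_le
    ((hi a b).absolutelyContinuousOnInterval_intervalIntegral Set.left_mem_uIcc) fun x y => ?_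
  rw [dist_eq_norm, hf.sub_eq, Real.dist_eq,
    intervalIntegral.integral_interval_sub_left (hi _ _) (hi _ _)]
  exact intervalIntegral.norm_integral_le_abs_integral_norm

theorem of_absolutelyContinuousOnInterval [CompleteSpace E]
    (hf : ∀ a b, AbsolutelyContinuousOnInterval f a b) (hf' : LocallyIntegrable f' volume)
    (hd : ∀ᵐ x, HasDerivAt f (f' x) x) : IsPrimitive f f' := by
  have hF := const_add_integral hf' 0
  refine ⟨hf', fun a b => ?_⟩
  obtain ⟨C, hC⟩ := ((hf a b).sub
      (hF.absolutelyContinuousOnInterval a b)).const_of_ae_hasDerivAt_zero (by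
    filter_upwards [hd, hF.ae_hasDerivAt] with x hx hFx _
    simpa only [sub_self] using hx.sub hFx)
  rw [← hF.sub_eq, sub_eq_sub_iff_sub_eq_sub]
  exact (hC b Set.right_mem_uIcc).trans (hC a Set.left_mem_uIcc).symm

theorem smul {𝕜 : Type*} [NormedField 𝕜] [NormedAlgebra ℝ 𝕜] [CompleteSpace 𝕜] [CompleteSpace E]
    [NormedSpace 𝕜 E] [IsScalarTower ℝ 𝕜 E] {g g' : ℝ → 𝕜} (hg : IsPrimitive g g')
    (hf : IsPrimitive f f') :
    IsPrimitive (fun x => g x • f x) (fun x => g x • f' x + g' x • f x) := by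
  have hgf' : LocallyIntegrableOn (fun x => g x • f' x) Set.univ volume :=
    (hf.locallyIntegrable.locallyIntegrableOn _).continuousOn_smul
      isOpen_univ.isLocallyClosed hg.continuous.continuousOn
  have hg'f : LocallyIntegrableOn (fun x => g' x • f x) Set.univ volume :=
    (hg.locallyIntegrable.locallyIntegrableOn _).smul_continuousOn
      isOpen_univ.isLocallyClosed hf.continuous.continuousOn
  refine of_absolutelyContinuousOnInterval
    (fun a b => (hg.absolutelyContinuousOnInterval a b).fun_smul
      (hf.absolutelyContinuousOnInterval a b))
    ((locallyIntegrableOn_univ.1 hgf').add (locallyIntegrableOn_univ.1 hg'f)) ?_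
  filter_upwards [hg.ae_hasDerivAt, hf.ae_hasDerivAt] with x hgx hfx
  exact hgx.fun_smul hfx

theorem integral_eq_zero_of_hasCompactSupport (hf : IsPrimitive f f') (hc : HasCompactSupport f)
    (hi : Integrable f') : ∫ x, f' x = 0 := by
  obtain ⟨R, -, hR⟩ := hc.exists_pos_le_norm
  refine tendsto_nhds_unique
    (intervalIntegral_tendsto_integral hi Filter.tendsto_neg_atTop_atBot Filter.tendsto_id)
    (tendsto_const_nhds.congr' ?_)
  filter_upwards [Filter.eventually_ge_atTop R] with r hr
  have hr' : R ≤ ‖r‖ := hr.trans (le_abs_self r)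
  rw [id, ← hf.sub_eq, hR r hr', hR (-r) (by rwa [norm_neg]), sub_zero]

theorem integral_deriv_smul [CompleteSpace E] (hf : IsPrimitive f f') {φ : ℝ → ℝ}
    (hφ : ContDiff ℝ 1 φ) (hc : HasCompactSupport φ) :
    ∫ x, deriv φ x • f x = -∫ x, φ x • f' x := by
  have hφf' : Integrable fun x => φ x • f' x :=
    hf.locallyIntegrable.integrable_smul_left_of_hasCompactSupport hφ.continuous hc
  have hφ'f : Integrable fun x => deriv φ x • f x :=
    (hf.continuous.locallyIntegrable (μ := volume)).integrable_smul_left_of_hasCompactSupport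
      (hφ.continuous_deriv le_rfl) hc.deriv
  rw [eq_neg_iff_add_eq_zero, add_comm, ← integral_add hφf' hφ'f]
  exact ((of_contDiff hφ).smul hf).integral_eq_zero_of_hasCompactSupport hc.smul_right
    (hφf'.add hφ'f)

theorem hasWeakDeriv {u v : L2} {f f' : ℝ → ℂ} (hf : IsPrimitive f f') (hu : u =ᵐ[volume] f)
    (hv : v =ᵐ[volume] f') : HasWeakDeriv u v := by
  intro φ hφ hc
  have hu' : ∫ x, deriv φ x • u x = ∫ x, deriv φ x • f x :=
    integral_congr_ae (by filter_upwards [hu] with x hx using by rw [hx])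
  have hv' : ∫ x, φ x • v x = ∫ x, φ x • f' x :=
    integral_congr_ae (by filter_upwards [hv] with x hx using by rw [hx])
  rw [hu', hv', hf.integral_deriv_smul (hφ.of_le (by simp)) hc]

end IsPrimitive

variable [CompleteSpace E]

theorem exists_contDiff_hasCompactSupport_deriv_eq {θ : ℝ → E} (hθ : ContDiff ℝ ∞ θ)
    (hc : HasCompactSupport θ) (h0 : ∫ x, θ x = 0) :
    ∃ φ : ℝ → E, ContDiff ℝ ∞ φ ∧ HasCompactSupport φ ∧ deriv φ = θ := by
  obtain ⟨R, -, hR⟩ := hc.exists_pos_le_norm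
  have hd : ∀ x, HasDerivAt (fun y => ∫ t in (-R)..y, θ t) (θ x) x := fun x =>
    intervalIntegral.integral_hasDerivAt_right (hθ.continuous.intervalIntegrable _ _)
      (hθ.continuous.stronglyMeasurableAtFilter _ _) hθ.continuous.continuousAt
  have hderiv : deriv (fun y => ∫ t in (-R)..y, θ t) = θ := funext fun x => (hd x).deriv
  refine ⟨fun y => ∫ t in (-R)..y, θ t, contDiff_infty_iff_deriv.2
    ⟨fun x => (hd x).differentiableAt, by rwa [hderiv]⟩,
    HasCompactSupport.intro (isCompact_closedBall 0 R) fun x hx => ?_, hderiv⟩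
  rw [mem_closedBall_zero_iff, Real.norm_eq_abs, not_le] at hx
  rcases lt_abs.1 hx with hx | hx
  · refine (intervalIntegral.integral_eq_integral_of_support_subset fun y hy => ?_).trans h0
    have hy' : |y| < R := not_le.1 fun h => hy (hR y h)
    exact ⟨(abs_lt.1 hy').1, (abs_lt.1 hy').2.le.trans hx.le⟩
  · refine (intervalIntegral.integral_congr (g := fun _ => 0) fun y hy => ?_).trans
      intervalIntegral.integral_zero
    rw [Set.uIcc_of_ge (by linarith)] at hy
    exact hR y (le_abs.2 (.inr (by linarith [hy.2])))

/-- The du Bois-Reymond lemma. -/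
theorem ae_eq_const_of_integral_deriv_smul_eq_zero {g : ℝ → E} (hg : LocallyIntegrable g volume)
    (h : ∀ φ : ℝ → ℝ, ContDiff ℝ ∞ φ → HasCompactSupport φ → ∫ x, deriv φ x • g x = 0) :
    ∃ c : E, ∀ᵐ x, g x = c := by
  obtain ⟨b⟩ : Nonempty (ContDiffBump (0 : ℝ)) := inferInstance
  set η : ℝ → ℝ := b.normed volume
  have hη : ContDiff ℝ ∞ η := b.contDiff_normed
  have hηc : HasCompactSupport η := b.hasCompactSupport_normed
  have hη1 : ∫ x, η x = 1 := b.integral_normed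
  refine ⟨∫ x, η x • g x, ae_eq_of_integral_contDiff_smul_eq hg (locallyIntegrable_const _)
    fun ψ hψ hψc => ?_⟩
  have hηi : Integrable η := hη.continuous.integrable_of_hasCompactSupport hηc
  have hψi : Integrable ψ := hψ.continuous.integrable_of_hasCompactSupport hψc
  -- Subtracting the multiple of `η` with the same integral makes `ψ` a derivative.
  obtain ⟨φ, hφ, hφc, hderiv⟩ := exists_contDiff_hasCompactSupport_deriv_eq
    (θ := fun x => ψ x - (∫ y, ψ y) * η x) (hψ.sub (contDiff_const.mul hη))
    (hψc.sub hηc.mul_left) (by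
      rw [integral_sub hψi (hηi.const_mul _), integral_const_mul, hη1, mul_one, sub_self])
  have hψg : Integrable fun x => ψ x • g x :=
    hg.integrable_smul_left_of_hasCompactSupport hψ.continuous hψc
  have hηg : Integrable fun x => (∫ y, ψ y) • η x • g x :=
    (hg.integrable_smul_left_of_hasCompactSupport hη.continuous hηc).fun_smul _
  have hzero := h φ hφ hφc
  simp only [hderiv, sub_smul, mul_smul] at hzero
  rw [integral_sub hψg hηg, integral_smul, sub_eq_zero] at hzero
  rw [hzero, integral_smul_const]

end Primitive

theorem L2.locallyIntegrable (u : L2) : LocallyIntegrable u volume :=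
  (Lp.memLp u).locallyIntegrable (by norm_num)

theorem HasWeakDeriv.exists_isPrimitive {u v : L2} (h : HasWeakDeriv u v) :
    ∃ f : ℝ → ℂ, IsPrimitive f v ∧ u =ᵐ[volume] f := by
  have hF := IsPrimitive.const_add_integral (L2.locallyIntegrable v) 0
  set F := fun x => (0 : ℂ) + ∫ t in (0 : ℝ)..x, v t with hFdef
  have hFi : LocallyIntegrable F volume := hF.continuous.locallyIntegrable
  obtain ⟨c, hc⟩ := ae_eq_const_of_integral_deriv_smul_eq_zero ((L2.locallyIntegrable u).sub hFi)
    fun φ hφ hφc => by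
      have hφ' : Continuous (deriv φ) := hφ.continuous_deriv (by simp)
      simp only [Pi.sub_apply, smul_sub]
      rw [integral_sub (integrable_test_smul hφ' hφc.deriv u)
        (hFi.integrable_smul_left_of_hasCompactSupport hφ' hφc.deriv), h φ hφ hφc,
        hF.integral_deriv_smul (hφ.of_le (by simp)) hφc, sub_self]
  refine ⟨_, IsPrimitive.const_add_integral (L2.locallyIntegrable v) c, ?_⟩
  filter_upwards [hc] with x hx
  rw [← hx, Pi.sub_apply, hFdef]
  ring

/-! ### The space `Ĥ¹` -/

theorem L2.norm_sq_eq_integral (f : L2) : ‖f‖ ^ 2 = ∫ x, ‖f x‖ ^ 2 := by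
  have hinner : (inner ℂ f f : ℂ) = ((∫ x, ‖f x‖ ^ 2 : ℝ) : ℂ) := by
    rw [MeasureTheory.L2.inner_def, ← integral_complex_ofReal]
    refine integral_congr_ae (.of_forall fun x => ?_)
    simp only [inner_self_eq_norm_sq_to_K, Complex.coe_algebraMap, Complex.ofReal_pow]
  rw [inner_self_eq_norm_sq_to_K] at hinner
  exact Complex.ofReal_injective (by rw [Complex.ofReal_pow]; exact hinner)

theorem L2.norm_star (f : L2) : ‖(star f : L2)‖ = ‖f‖ :=
  congrArg ENNReal.toReal (AEEqFun.eLpNorm_star (f := (f : ℝ →ₘ[volume] ℂ)))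

theorem L2.coeFn_star (f : L2) : ∀ᵐ x : ℝ, (star f : L2) x = starRingEnd ℂ (f x) :=
  Lp.coeFn_star f

theorem continuous_integral_test_smul {φ : ℝ → ℝ} (hφ : Continuous φ)
    (hc : HasCompactSupport φ) : Continuous fun u : L2 => ∫ x, φ x • u x := by
  have hφL2 : MemLp (fun x => (φ x : ℂ)) 2 (volume : Measure ℝ) :=
    (Complex.continuous_ofReal.comp hφ).memLp_of_hasCompactSupport
      (hc.comp_left Complex.ofReal_zero)
  have hinner : (fun u : L2 => ∫ x, φ x • u x) = fun u => inner ℂ hφL2.toLp u := by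
    funext u
    rw [MeasureTheory.L2.inner_def]
    refine integral_congr_ae ?_
    filter_upwards [hφL2.coeFn_toLp] with x hx
    rw [hx, RCLike.inner_apply, Complex.conj_ofReal, Complex.real_smul, mul_comm]
  rw [hinner]
  exact continuous_const.inner continuous_id

theorem HasWeakDeriv.star {u v : L2} (h : HasWeakDeriv u v) : HasWeakDeriv (star u) (star v) := by
  have hconj : ∀ (ψ : ℝ → ℝ) (f : L2),
      ∫ x, ψ x • (Star.star f : L2) x = starRingEnd ℂ (∫ x, ψ x • f x) := by
    intro ψ f
    rw [← integral_conj]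
    refine integral_congr_ae ?_
    filter_upwards [L2.coeFn_star f] with x hx
    rw [hx, Complex.real_smul, Complex.real_smul, map_mul, Complex.conj_ofReal]
  intro φ hφ hc
  rw [hconj, hconj, h φ hφ hc, map_neg]

theorem HasWeakDeriv.eq_zero_of_zero_left {v : L2} (h : HasWeakDeriv 0 v) : v = 0 := by
  refine Lp.eq_zero_iff_ae_eq_zero.2 <|
    ae_eq_zero_of_integral_contDiff_smul_eq_zero v.locallyIntegrable fun φ hφ hc => ?_
  have hzero : ∫ x, deriv φ x • (0 : L2) x = 0 := by
    rw [integral_eq_zero_of_ae]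
    filter_upwards [Lp.coeFn_zero ℂ 2 (volume : Measure ℝ)] with x hx
    rw [hx, Pi.zero_apply, smul_zero]
  rw [← neg_eq_zero, ← h φ hφ hc, hzero]

theorem isClosed_setOf_hasWeakDeriv : IsClosed {w : L2 × L2 | HasWeakDeriv w.1 w.2} := by
  simp only [HasWeakDeriv, Set.ofPred_forall]
  refine isClosed_iInter fun φ => isClosed_iInter fun hφ => isClosed_iInter fun hc => ?_
  exact isClosed_eq
    ((continuous_integral_test_smul (hφ.continuous_deriv (by simp)) hc.deriv).comp continuous_fst)
    ((continuous_integral_test_smul hφ.continuous hc).comp continuous_snd).neg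

theorem ae_eq_mul_iff {g : ℝ → ℝ} (hg : Continuous g) (a b : L2) :
    (∀ᵐ x : ℝ, b x = (g x : ℂ) * a x) ↔
      ∀ φ : ℝ → ℝ, ContDiff ℝ ∞ φ → HasCompactSupport φ →
        ∫ x, φ x • b x = ∫ x, (φ x * g x) • a x := by
  have hga : LocallyIntegrableOn (fun x => (g x : ℂ) * a x) Set.univ volume :=
    (a.locallyIntegrable.locallyIntegrableOn _).continuousOn_mul
      (Complex.continuous_ofReal.comp hg).continuousOn isOpen_univ.isLocallyClosed
  have hsmul : ∀ (φ : ℝ → ℝ) (x : ℝ), φ x • ((g x : ℂ) * a x) = (φ x * g x) • a x := fun φ x => by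
    rw [mul_smul, Complex.real_smul (x := g x)]
  constructor
  · intro h φ _ _
    refine integral_congr_ae ?_
    filter_upwards [h] with x hx
    rw [hx, hsmul]
  · intro h
    refine ae_eq_of_integral_contDiff_smul_eq b.locallyIntegrable (locallyIntegrableOn_univ.1 hga)
      fun φ hφ hc => ?_
    rw [h φ hφ hc]
    exact integral_congr_ae (.of_forall fun x => (hsmul φ x).symm)

theorem isClosed_setOf_ae_eq_mul {g : ℝ → ℝ} (hg : Continuous g) :
    IsClosed {w : L2 × L2 | ∀ᵐ x : ℝ, w.2 x = (g x : ℂ) * w.1 x} := by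
  simp only [ae_eq_mul_iff hg, Set.ofPred_forall]
  refine isClosed_iInter fun φ => isClosed_iInter fun hφ => isClosed_iInter fun hc => ?_
  exact isClosed_eq ((continuous_integral_test_smul hφ.continuous hc).comp continuous_snd)
    ((continuous_integral_test_smul (hφ.continuous.mul hg) hc.mul_right).comp continuous_fst)

theorem continuous_bracket : Continuous bracket := by
  unfold bracket; fun_prop

theorem isClosed_Hhat1 : IsClosed (Hhat1 : Set (PiLp 2 fun _ : Fin 3 => L2)) := by
  have hproj : ∀ i, Continuous fun w : PiLp 2 (fun _ : Fin 3 => L2) => w i := fun i =>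
    (PiLp.proj (𝕜 := ℂ) 2 (fun _ : Fin 3 => L2) i).continuous
  exact (isClosed_setOf_hasWeakDeriv.preimage ((hproj 0).prodMk (hproj 1))).inter
    ((isClosed_setOf_ae_eq_mul continuous_bracket).preimage ((hproj 0).prodMk (hproj 2)))

instance : CompleteSpace Hhat1 := isClosed_Hhat1.completeSpace_coe

/-- The weighted function `⟨x⟩ u`, from `Ĥ¹` to `L²`. -/
def wt : Hhat1 →L[ℂ] L2 :=
  (PiLp.proj 2 (fun _ : Fin 3 => L2) (2 : Fin 3)).comp Hhat1.subtypeL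

theorem wt_ae_eq (u : Hhat1) : ∀ᵐ x : ℝ, wt u x = (bracket x : ℂ) * fn u x := u.2.2

theorem hasWeakDeriv_dx (u : Hhat1) : HasWeakDeriv (fn u) (dx u) := u.2.1

theorem norm_fn_le (u : Hhat1) : ‖fn u‖ ≤ ‖u‖ := PiLp.norm_apply_le u.1 0

theorem norm_dx_le (u : Hhat1) : ‖dx u‖ ≤ ‖u‖ := PiLp.norm_apply_le u.1 1

theorem norm_wt_le (u : Hhat1) : ‖wt u‖ ≤ ‖u‖ := PiLp.norm_apply_le u.1 2

theorem fn_add_ae (u v : Hhat1) : ∀ᵐ x : ℝ, fn (u + v) x = fn u x + fn v x := by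
  rw [map_add]; exact Lp.coeFn_add _ _

theorem fn_sub_ae (u v : Hhat1) : ∀ᵐ x : ℝ, fn (u - v) x = fn u x - fn v x := by
  rw [map_sub]; exact Lp.coeFn_sub _ _

theorem fn_smul_ae (c : ℂ) (u : Hhat1) : ∀ᵐ x : ℝ, fn (c • u) x = c * fn u x := by
  rw [map_smul]; exact Lp.coeFn_smul _ _

theorem integral_norm_unit_le (f : L2) (a : ℝ) : ∫ x in a..a + 1, ‖f x‖ ≤ ‖f‖ := by
  have : IsProbabilityMeasure ((volume : Measure ℝ).restrict (Set.Ioc a (a + 1))) := ⟨by simp⟩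
  rw [intervalIntegral.integral_of_le (by linarith), integral_norm_eq_lintegral_enorm
    (Lp.aestronglyMeasurable f).restrict, Lp.norm_def, ← eLpNorm_one_eq_lintegral_enorm]
  refine ENNReal.toReal_mono (Lp.eLpNorm_ne_top f) ?_
  calc eLpNorm f 1 (volume.restrict (Set.Ioc a (a + 1)))
      ≤ eLpNorm f 2 (volume.restrict (Set.Ioc a (a + 1))) :=
        eLpNorm_le_eLpNorm_of_exponent_le (by norm_num) (Lp.aestronglyMeasurable f).restrict
    _ ≤ eLpNorm f 2 volume := eLpNorm_mono_measure _ Measure.restrict_le_self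

theorem IsPrimitive.norm_le_add_of_mem_Icc {f : ℝ → ℂ} {v : L2} (hf : IsPrimitive f v) {x y : ℝ}
    (hy : y ∈ Set.Icc x (x + 1)) : ‖f x‖ ≤ ‖f y‖ + ‖v‖ := by
  have hint : ‖∫ t in x..y, v t‖ ≤ ‖v‖ :=
    calc ‖∫ t in x..y, v t‖ ≤ ∫ t in x..y, ‖v t‖ :=
          intervalIntegral.norm_integral_le_integral_norm hy.1
      _ ≤ ∫ t in x..x + 1, ‖v t‖ :=
          intervalIntegral.integral_mono_interval le_rfl hy.1 hy.2
            (.of_forall fun t => norm_nonneg _)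
            (intervalIntegrable_of_locallyIntegrable hf.locallyIntegrable _ _).norm
      _ ≤ ‖v‖ := integral_norm_unit_le v x
  have hfx : f x = f y - ∫ t in x..y, v t := by rw [← hf.sub_eq, sub_sub_cancel]
  rw [hfx]
  exact (norm_sub_le _ _).trans (add_le_add_right hint _)

theorem ae_norm_fn_le (u : Hhat1) : ∀ᵐ x : ℝ, ‖fn u x‖ ≤ 2 * ‖u‖ := by
  obtain ⟨f, hf, hu⟩ := (hasWeakDeriv_dx u).exists_isPrimitive
  filter_upwards [hu] with x hx
  have hnorm : IntervalIntegrable (fun y => ‖f y‖) volume x (x + 1) :=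
    hf.continuous.norm.intervalIntegrable _ _
  calc ‖fn u x‖ = ∫ _ in x..x + 1, ‖f x‖ := by
        rw [hx, intervalIntegral.integral_const, add_sub_cancel_left, one_smul]
    _ ≤ ∫ y in x..x + 1, (‖f y‖ + ‖dx u‖) :=
        intervalIntegral.integral_mono_on (by linarith) (by simp)
          (hnorm.add intervalIntegrable_const) fun y hy => hf.norm_le_add_of_mem_Icc hy
    _ = (∫ y in x..x + 1, ‖fn u y‖) + ‖dx u‖ := by
        rw [intervalIntegral.integral_add hnorm intervalIntegrable_const,
          intervalIntegral.integral_const, add_sub_cancel_left, one_smul]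
        congr 1
        refine intervalIntegral.integral_congr_ae ?_
        filter_upwards [hu] with y hy _
        rw [hy]
    _ ≤ 2 * ‖u‖ := by linarith [integral_norm_unit_le (fn u) x, norm_fn_le u, norm_dx_le u]

/-- The pointwise product of an `L²` function with an element of `Ĥ¹`. -/
def mulL2 (f : L2) (v : Hhat1) : L2 :=
  ((memLp_top_of_bound (Lp.aestronglyMeasurable (fn v)) _ (ae_norm_fn_le v)).mul' (Lp.memLp f)).toLp

theorem mulL2_ae_eq (f : L2) (v : Hhat1) : ∀ᵐ x : ℝ, mulL2 f v x = f x * fn v x :=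
  MemLp.coeFn_toLp _

theorem norm_mulL2_le (f : L2) (v : Hhat1) : ‖mulL2 f v‖ ≤ 2 * ‖v‖ * ‖f‖ := by
  refine Lp.norm_le_mul_norm_of_ae_le_mul ?_
  filter_upwards [mulL2_ae_eq f v, ae_norm_fn_le v] with x hmul hv
  rw [hmul, norm_mul, mul_comm]
  exact mul_le_mul_of_nonneg_right hv (norm_nonneg _)

namespace Hhat1

theorem inner_eq (u v : Hhat1) :
    inner ℂ u v = inner ℂ (fn u) (fn v) + inner ℂ (dx u) (dx v) + inner ℂ (wt u) (wt v) := by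
  change inner ℂ u.1 v.1 = _
  rw [PiLp.inner_apply, Fin.sum_univ_three]
  rfl

theorem norm_sq_eq (u : Hhat1) : ‖u‖ ^ 2 = ‖fn u‖ ^ 2 + ‖dx u‖ ^ 2 + ‖wt u‖ ^ 2 := by
  change ‖u.1‖ ^ 2 = _
  rw [PiLp.norm_sq_eq_of_L2, Fin.sum_univ_three]
  rfl

theorem norm_le_add (u : Hhat1) : ‖u‖ ≤ ‖fn u‖ + ‖dx u‖ + ‖wt u‖ := by
  refine le_of_sq_le_sq ?_ (by positivity)
  rw [norm_sq_eq]
  nlinarith [mul_nonneg (norm_nonneg (fn u)) (norm_nonneg (dx u)),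
    mul_nonneg (norm_nonneg (fn u)) (norm_nonneg (wt u)),
    mul_nonneg (norm_nonneg (dx u)) (norm_nonneg (wt u))]

theorem ext_fn {u v : Hhat1} (h : fn u = fn v) : u = v := by
  have hfn : fn (u - v) = 0 := by rw [map_sub, h, sub_self]
  have hdx : dx (u - v) = 0 := (hfn ▸ hasWeakDeriv_dx (u - v)).eq_zero_of_zero_left
  have hwt : wt (u - v) = 0 := by
    refine Lp.eq_zero_iff_ae_eq_zero.2 ?_
    filter_upwards [wt_ae_eq (u - v), Lp.eq_zero_iff_ae_eq_zero.1 hfn] with x hx hx0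
    rw [hx, hx0, Pi.zero_apply, mul_zero]
  have hsq := norm_sq_eq (u - v)
  rw [hfn, hdx, hwt] at hsq
  rw [← sub_eq_zero, ← norm_eq_zero, ← sq_eq_zero_iff, hsq]
  simp

theorem ext_ae {u v : Hhat1} (h : ∀ᵐ x : ℝ, fn u x = fn v x) : u = v :=
  ext_fn (Lp.ext h)

/-- The pointwise product on `Ĥ¹`. -/
def mul (u v : Hhat1) : Hhat1 :=
  ⟨WithLp.toLp 2 ![mulL2 (fn u) v, mulL2 (dx v) u + mulL2 (dx u) v, mulL2 (wt u) v], by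
    constructor
    · obtain ⟨f, hf, hfu⟩ := (hasWeakDeriv_dx u).exists_isPrimitive
      obtain ⟨g, hg, hgv⟩ := (hasWeakDeriv_dx v).exists_isPrimitive
      refine (hf.smul hg).hasWeakDeriv ?_ ?_
      · filter_upwards [mulL2_ae_eq (fn u) v, hfu, hgv] with x huv hu hv
        change mulL2 (fn u) v x = _
        rw [huv, hu, hv, smul_eq_mul]
      · filter_upwards [mulL2_ae_eq (dx v) u, mulL2_ae_eq (dx u) v, hfu, hgv,
          Lp.coeFn_add (mulL2 (dx v) u) (mulL2 (dx u) v)] with x hvu huv hu hv hadd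
        change (mulL2 (dx v) u + mulL2 (dx u) v) x = _
        rw [hadd, Pi.add_apply, hvu, huv, hu, hv, smul_eq_mul, smul_eq_mul, mul_comm (f x)]
    · filter_upwards [mulL2_ae_eq (wt u) v, mulL2_ae_eq (fn u) v, wt_ae_eq u] with x hwt hfn hu
      change mulL2 (wt u) v x = _ * mulL2 (fn u) v x
      rw [hwt, hfn, hu, mul_assoc]⟩

theorem fn_mul_ae (u v : Hhat1) : ∀ᵐ x : ℝ, fn (mul u v) x = fn u x * fn v x :=
  mulL2_ae_eq (fn u) v

theorem norm_fn_mul_le (u v : Hhat1) : ‖fn (mul u v)‖ ≤ 2 * ‖v‖ * ‖fn u‖ :=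
  norm_mulL2_le (fn u) v

theorem norm_mul_le (u v : Hhat1) : ‖mul u v‖ ≤ 8 * ‖u‖ * ‖v‖ := by
  have hfn : ‖fn (mul u v)‖ ≤ 2 * ‖v‖ * ‖u‖ :=
    (norm_fn_mul_le u v).trans (by gcongr; exact norm_fn_le u)
  have hwt : ‖wt (mul u v)‖ ≤ 2 * ‖v‖ * ‖u‖ :=
    (norm_mulL2_le (wt u) v).trans (by gcongr; exact norm_wt_le u)
  have hdx : ‖dx (mul u v)‖ ≤ 2 * ‖u‖ * ‖v‖ + 2 * ‖v‖ * ‖u‖ := by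
    refine (norm_add_le _ _).trans (add_le_add (norm_mulL2_le _ _) (norm_mulL2_le _ _) |>.trans ?_)
    gcongr
    exacts [norm_dx_le v, norm_dx_le u]
  linarith [norm_le_add (mul u v)]

protected theorem mul_comm (u v : Hhat1) : mul u v = mul v u := by
  refine ext_ae ?_
  filter_upwards [fn_mul_ae u v, fn_mul_ae v u] with x huv hvu
  rw [huv, hvu, _root_.mul_comm]

protected theorem mul_sub (u v w : Hhat1) : mul u (v - w) = mul u v - mul u w := by
  refine ext_ae ?_
  filter_upwards [fn_mul_ae u (v - w), fn_mul_ae u v, fn_mul_ae u w, fn_sub_ae v w,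
    fn_sub_ae (mul u v) (mul u w)] with x hmul huv huw hsub hsub'
  rw [hmul, hsub', huv, huw, hsub, _root_.mul_sub]

/-- Complex conjugation on `Ĥ¹`. -/
def conj (u : Hhat1) : Hhat1 :=
  ⟨WithLp.toLp 2 ![star (fn u), star (dx u), star (wt u)], (hasWeakDeriv_dx u).star, by
    filter_upwards [L2.coeFn_star (fn u), L2.coeFn_star (wt u), wt_ae_eq u] with x hfn hwt hu
    change (star (wt u) : L2) x = _ * (star (fn u) : L2) x
    rw [hfn, hwt, hu, map_mul, Complex.conj_ofReal]⟩

theorem fn_conj (u : Hhat1) : fn (conj u) = star (fn u) := rfl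

theorem dx_conj (u : Hhat1) : dx (conj u) = star (dx u) := rfl

theorem wt_conj (u : Hhat1) : wt (conj u) = star (wt u) := rfl

theorem fn_conj_ae (u : Hhat1) : ∀ᵐ x : ℝ, fn (conj u) x = starRingEnd ℂ (fn u x) :=
  L2.coeFn_star (fn u)

theorem norm_conj (u : Hhat1) : ‖conj u‖ = ‖u‖ := by
  rw [← sq_eq_sq₀ (norm_nonneg _) (norm_nonneg _), norm_sq_eq, norm_sq_eq, fn_conj, dx_conj,
    wt_conj, L2.norm_star, L2.norm_star, L2.norm_star]

theorem conj_conj (u : Hhat1) : conj (conj u) = u :=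
  ext_fn (star_star (fn u))

theorem conj_sub (u v : Hhat1) : conj (u - v) = conj u - conj v := by
  refine ext_ae ?_
  filter_upwards [fn_conj_ae (u - v), fn_conj_ae u, fn_conj_ae v, fn_sub_ae u v,
    fn_sub_ae (conj u) (conj v)] with x hconj hu hv hsub hsub'
  rw [hconj, hsub', hu, hv, hsub, map_sub]

end Hhat1

/-! ### The unitary group generated by the inverse of a self-adjoint operator -/

/-- The function `z ↦ z exp(-it/z)`, which is continuous on the real line: the functional calculus
turns it into the operator `A exp(-itA⁻¹)`. Only the real part of `z` enters the exponential, and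
`t / 0 = 0` is harmless because of the prefactor `z`. -/
def phase (t : ℝ) (z : ℂ) : ℂ := z * Complex.exp (Complex.I * ((-(t / z.re) : ℝ) : ℂ))

theorem norm_phase (t : ℝ) (z : ℂ) : ‖phase t z‖ = ‖z‖ := by
  rw [phase, norm_mul, Complex.norm_exp_I_mul_ofReal, mul_one]

theorem phase_apply_zero (t : ℝ) : phase t 0 = 0 := zero_mul _

theorem phase_add (s t : ℝ) (z : ℂ) :
    phase (s + t) z = phase s z * Complex.exp (Complex.I * ((-(t / z.re) : ℝ) : ℂ)) := by
  rw [phase, phase, mul_assoc, ← Complex.exp_add, ← mul_add, ← Complex.ofReal_add, add_div, neg_add]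

theorem continuousOn_phase (t : ℝ) {s : Set ℂ} (hs : ∀ z ∈ s, z = z.re) :
    ContinuousOn (phase t) s := by
  intro z hz
  refine ContinuousAt.continuousWithinAt ?_
  by_cases hre : z.re = 0
  · have hz0 : z = 0 := by rw [hs z hz, hre, Complex.ofReal_zero]
    rw [ContinuousAt, hz0, phase_apply_zero]
    exact squeeze_zero_norm (fun z => (norm_phase t z).le) tendsto_norm_zero
  · have harg : ContinuousAt (fun z : ℂ => -(t / z.re)) z :=
      (continuousAt_const.div Complex.continuous_re.continuousAt hre).neg
    exact continuousAt_id.mul (Complex.continuous_exp.continuousAt.comp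
      (continuousAt_const.mul (Complex.continuous_ofReal.continuousAt.comp harg)))

theorem norm_phase_sub_phase_le (s t x : ℝ) : ‖phase s x - phase t x‖ ≤ |s - t| := by
  have hfactor : phase s x - phase t x =
      phase t x * (Complex.exp (Complex.I * ((-((s - t) / x) : ℝ) : ℂ)) - 1) := by
    conv_lhs => rw [← add_sub_cancel t s, phase_add, Complex.ofReal_re]
    ring
  rcases eq_or_ne x 0 with rfl | hx
  · simp [phase_apply_zero]
  calc ‖phase s x - phase t x‖ ≤ |x| * |-((s - t) / x)| := by
        rw [hfactor, norm_mul, norm_phase, Complex.norm_real, Real.norm_eq_abs]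
        exact mul_le_mul_of_nonneg_left Real.norm_exp_I_mul_ofReal_sub_one_le (abs_nonneg x)
    _ = |s - t| := by rw [abs_neg, ← abs_mul, mul_div_cancel₀ _ hx]

theorem norm_exp_I_sub_one_sub_le (a : ℝ) :
    ‖Complex.exp (Complex.I * a) - 1 - Complex.I * a‖ ≤ 3 * a ^ 2 := by
  have hnorm : ‖Complex.I * (a : ℂ)‖ = |a| := by
    rw [norm_mul, Complex.norm_I, one_mul, Complex.norm_real, Real.norm_eq_abs]
  rw [← sq_abs]
  rcases le_or_gt |a| 1 with ha | ha
  · have hquad := Complex.norm_exp_sub_one_sub_id_le (x := Complex.I * a) (by rwa [hnorm])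
    rw [hnorm] at hquad
    linarith [sq_nonneg |a|]
  · calc ‖Complex.exp (Complex.I * a) - 1 - Complex.I * a‖ ≤ |a| + |a| :=
          (norm_sub_le _ _).trans (add_le_add Real.norm_exp_I_mul_ofReal_sub_one_le hnorm.le)
      _ ≤ 3 * |a| ^ 2 := by nlinarith

theorem norm_mul_phase_sub_le (s t x : ℝ) :
    ‖x * phase (t + s) x - x * phase t x - s * (-Complex.I * phase t x)‖ ≤ 3 * s ^ 2 := by
  rcases eq_or_ne x 0 with rfl | hx
  · simp only [Complex.ofReal_zero, phase_apply_zero, mul_zero, sub_zero, norm_zero]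
    positivity
  have hx' : (x : ℂ) ≠ 0 := Complex.ofReal_ne_zero.2 hx
  set a : ℝ := -(s / x) with ha
  have hfactor : x * phase (t + s) x - x * phase t x - s * (-Complex.I * phase t x) =
      x * phase t x * (Complex.exp (Complex.I * a) - 1 - Complex.I * a) := by
    rw [phase_add, Complex.ofReal_re, ← ha, ha]
    push_cast
    field_simp
  rw [hfactor, norm_mul, norm_mul, norm_phase, Complex.norm_real, Real.norm_eq_abs,
    ← sq, sq_abs]
  calc x ^ 2 * _ ≤ x ^ 2 * (3 * a ^ 2) :=
        mul_le_mul_of_nonneg_left (norm_exp_I_sub_one_sub_le a) (sq_nonneg x)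
    _ = 3 * s ^ 2 := by rw [ha]; field_simp

section UnitaryGroup

variable {X : Type*} [NormedAddCommGroup X] [InnerProductSpace ℂ X] [CompleteSpace X]

/-- The operator `A exp(-itA⁻¹)`, for a self-adjoint operator `A`. -/
def smoothedGroup (A : X →L[ℂ] X) (t : ℝ) : X →L[ℂ] X := cfc (phase t) A

/-- The unitary group `exp(-itA⁻¹)`, for an injective self-adjoint operator `A`: the isometry
`A x ↦ A exp(-itA⁻¹) x` extended from the range of `A`, which is dense. -/
def unitaryGroup (A : X →L[ℂ] X) (t : ℝ) : X →L[ℂ] X :=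
  (smoothedGroup A t : X →ₗ[ℂ] X).extendOfNorm (A : X →ₗ[ℂ] X)

variable {A : X →L[ℂ] X}

theorem continuousOn_phase_spectrum (hA : IsSelfAdjoint A) (t : ℝ) :
    ContinuousOn (phase t) (spectrum ℂ A) :=
  continuousOn_phase t fun _ hz => hA.mem_spectrum_eq_re hz

theorem smoothedGroup_zero (hA : IsSelfAdjoint A) : smoothedGroup A 0 = A := by
  have := hA.isStarNormal
  have hphase : phase 0 = fun z => z := by
    funext z
    rw [phase, zero_div, neg_zero, Complex.ofReal_zero, mul_zero, Complex.exp_zero, mul_one]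
  rw [smoothedGroup, hphase, cfc_id' ℂ A]

theorem mul_smoothedGroup (hA : IsSelfAdjoint A) (t : ℝ) :
    A * smoothedGroup A t = cfc (fun z => z * phase t z) A := by
  have := hA.isStarNormal
  rw [cfc_mul (fun z : ℂ => z) (phase t) A continuousOn_id (continuousOn_phase_spectrum hA t),
    cfc_id' ℂ A, smoothedGroup]

theorem smoothedGroup_mul (hA : IsSelfAdjoint A) (s t : ℝ) :
    smoothedGroup A s * smoothedGroup A t = A * smoothedGroup A (s + t) := by
  rw [mul_smoothedGroup hA, smoothedGroup, smoothedGroup,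
    ← cfc_mul _ _ A (continuousOn_phase_spectrum hA s) (continuousOn_phase_spectrum hA t)]
  refine cfc_congr fun z _ => ?_
  simp only [phase_add]
  rw [phase.eq_1 t]
  ring

theorem smoothedGroup_apply_commute (hA : IsSelfAdjoint A) (t : ℝ) (x : X) :
    smoothedGroup A t (A x) = A (smoothedGroup A t x) := by
  have hcomm : Commute (smoothedGroup A t) (smoothedGroup A 0) := cfc_commute_cfc _ _ _
  rw [smoothedGroup_zero hA] at hcomm
  exact congrArg (fun T : X →L[ℂ] X => T x) hcomm.eq

theorem star_smoothedGroup_mul_self (hA : IsSelfAdjoint A) (t : ℝ) :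
    star (smoothedGroup A t) * smoothedGroup A t = A * A := by
  have := hA.isStarNormal
  have hcont := continuousOn_phase_spectrum hA t
  have hsq : A * A = cfc (fun z : ℂ => z * z) A := by
    rw [cfc_mul (fun z : ℂ => z) (fun z => z) A, cfc_id' ℂ A]
  rw [smoothedGroup, ← cfc_star, ← cfc_mul (fun z => star (phase t z)) _ A hcont.star hcont, hsq]
  refine cfc_congr fun z hz => ?_
  obtain ⟨x, rfl⟩ : ∃ x : ℝ, z = x := ⟨z.re, hA.mem_spectrum_eq_re hz⟩
  calc star (phase t x) * phase t x = (‖phase t x‖ : ℂ) ^ 2 := Complex.conj_mul' _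
    _ = x * x := by
      rw [norm_phase, Complex.norm_real, Real.norm_eq_abs, ← Complex.ofReal_pow, sq_abs, sq,
        Complex.ofReal_mul]

theorem norm_smoothedGroup_apply (hA : IsSelfAdjoint A) (t : ℝ) (x : X) :
    ‖smoothedGroup A t x‖ = ‖A x‖ := by
  have hnorm : ∀ T : X →L[ℂ] X, ‖T x‖ ^ 2 = RCLike.re (inner ℂ ((star T * T) x) x) := fun T =>
    T.apply_norm_sq_eq_inner_adjoint_left x
  rw [← sq_eq_sq₀ (norm_nonneg _) (norm_nonneg _), hnorm, hnorm, star_smoothedGroup_mul_self hA,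
    hA.star_eq]

theorem norm_smoothedGroup_sub_le (hA : IsSelfAdjoint A) (s t : ℝ) :
    ‖smoothedGroup A s - smoothedGroup A t‖ ≤ |s - t| := by
  rw [smoothedGroup, smoothedGroup, ← cfc_sub _ _ A (continuousOn_phase_spectrum hA s)
    (continuousOn_phase_spectrum hA t)]
  refine norm_cfc_le (abs_nonneg _) fun z hz => ?_
  obtain ⟨x, rfl⟩ : ∃ x : ℝ, z = x := ⟨z.re, hA.mem_spectrum_eq_re hz⟩
  exact norm_phase_sub_phase_le s t x

theorem hasDerivAt_mul_smoothedGroup (hA : IsSelfAdjoint A) (t : ℝ) :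
    HasDerivAt (fun s => A * smoothedGroup A s) (-Complex.I • smoothedGroup A t) t := by
  have hquad : ∀ s : ℝ, ‖A * smoothedGroup A (t + s) - A * smoothedGroup A t -
      s • (-Complex.I • smoothedGroup A t)‖ ≤ 3 * s ^ 2 := by
    intro s
    have hid : ContinuousOn (fun z : ℂ => z) (spectrum ℂ A) := continuousOn_id
    have hcont := continuousOn_phase_spectrum hA
    rw [mul_smoothedGroup hA, mul_smoothedGroup hA, smoothedGroup, ← Complex.coe_smul,
      ← cfc_sub (fun z => z * phase (t + s) z) (fun z => z * phase t z) A
        (hid.mul (hcont (t + s))) (hid.mul (hcont t)),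
      ← cfc_const_mul _ (phase t) A (hcont t),
      ← cfc_const_mul _ (fun z => -Complex.I * phase t z) A ((hcont t).const_mul _),
      ← cfc_sub (fun z => z * phase (t + s) z - z * phase t z)
        (fun z => s * (-Complex.I * phase t z)) A
        ((hid.mul (hcont (t + s))).sub (hid.mul (hcont t))) (((hcont t).const_mul _).const_mul _)]
    refine norm_cfc_le (by positivity) fun z hz => ?_
    obtain ⟨x, rfl⟩ : ∃ x : ℝ, z = x := ⟨z.re, hA.mem_spectrum_eq_re hz⟩
    exact norm_mul_phase_sub_le s t x
  rw [hasDerivAt_iff_isLittleO_nhds_zero]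
  have hbigO : (fun s => A * smoothedGroup A (t + s) - A * smoothedGroup A t -
      s • (-Complex.I • smoothedGroup A t)) =O[nhds 0] fun s : ℝ => s ^ 2 :=
    .of_bound 3 (.of_forall fun s => by rw [norm_pow, Real.norm_eq_abs, sq_abs]; exact hquad s)
  exact hbigO.trans_isLittleO (Asymptotics.isLittleO_pow_id (by norm_num))

theorem denseRange_of_injective (hA : IsSelfAdjoint A) (hinj : Function.Injective A) :
    DenseRange A := by
  have horth := A.orthogonal_range
  rw [show ContinuousLinearMap.adjoint A = A from hA, LinearMap.ker_eq_bot.2 hinj,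
    ← Submodule.topologicalClosure_eq_top_iff,
    ← Submodule.dense_iff_topologicalClosure_eq_top] at horth
  exact horth

theorem unitaryGroup_apply_range (hA : IsSelfAdjoint A) (hinj : Function.Injective A) (t : ℝ)
    (x : X) : unitaryGroup A t (A x) = smoothedGroup A t x :=
  LinearMap.extendOfNorm_eq (f := (smoothedGroup A t : X →ₗ[ℂ] X)) (e := (A : X →ₗ[ℂ] X))
    (denseRange_of_injective hA hinj)
    ⟨1, fun x => by simpa using (norm_smoothedGroup_apply hA t x).le⟩ x

theorem norm_unitaryGroup_le (hA : IsSelfAdjoint A) (hinj : Function.Injective A) (t : ℝ)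
    (x : X) : ‖unitaryGroup A t x‖ ≤ ‖x‖ := by
  have hle := LinearMap.norm_extendOfNorm_apply_le (f := (smoothedGroup A t : X →ₗ[ℂ] X))
    (e := (A : X →ₗ[ℂ] X)) (denseRange_of_injective hA hinj) 1
    (fun x => by simpa using (norm_smoothedGroup_apply hA t x).le) x
  rwa [one_mul] at hle

theorem unitaryGroup_zero (hA : IsSelfAdjoint A) (hinj : Function.Injective A) (x : X) :
    unitaryGroup A 0 x = x := by
  refine (denseRange_of_injective hA hinj).induction_on x
    (isClosed_eq (unitaryGroup A 0).continuous continuous_id) fun y => ?_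
  rw [unitaryGroup_apply_range hA hinj, smoothedGroup_zero hA]

theorem unitaryGroup_apply_commute (hA : IsSelfAdjoint A) (hinj : Function.Injective A) (t : ℝ)
    (x : X) : unitaryGroup A t (A x) = A (unitaryGroup A t x) := by
  refine (denseRange_of_injective hA hinj).induction_on x
    (isClosed_eq ((unitaryGroup A t).continuous.comp A.continuous)
      (A.continuous.comp (unitaryGroup A t).continuous)) fun y => ?_
  rw [unitaryGroup_apply_range hA hinj, unitaryGroup_apply_range hA hinj,
    smoothedGroup_apply_commute hA]

theorem unitaryGroup_add (hA : IsSelfAdjoint A) (hinj : Function.Injective A) (s t : ℝ) (x : X) :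
    unitaryGroup A (s + t) x = unitaryGroup A s (unitaryGroup A t x) := by
  apply hinj
  rw [← unitaryGroup_apply_commute hA hinj, ← unitaryGroup_apply_commute hA hinj s,
    ← unitaryGroup_apply_commute hA hinj t, unitaryGroup_apply_range hA hinj t]
  refine (denseRange_of_injective hA hinj).induction_on x
    (isClosed_eq ((unitaryGroup A (s + t)).continuous.comp A.continuous)
      ((unitaryGroup A s).continuous.comp (smoothedGroup A t).continuous)) fun y => ?_
  rw [unitaryGroup_apply_range hA hinj, smoothedGroup_apply_commute hA,
    smoothedGroup_apply_commute hA, unitaryGroup_apply_range hA hinj]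
  exact congrArg (fun T : X →L[ℂ] X => T y) (smoothedGroup_mul hA s t).symm

theorem unitaryGroup_neg_apply (hA : IsSelfAdjoint A) (hinj : Function.Injective A) (t : ℝ)
    (x : X) : unitaryGroup A (-t) (unitaryGroup A t x) = x := by
  rw [← unitaryGroup_add hA hinj, neg_add_cancel, unitaryGroup_zero hA hinj]

theorem unitaryGroup_apply_neg (hA : IsSelfAdjoint A) (hinj : Function.Injective A) (t : ℝ)
    (x : X) : unitaryGroup A t (unitaryGroup A (-t) x) = x := by
  rw [← unitaryGroup_add hA hinj, add_neg_cancel, unitaryGroup_zero hA hinj]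

theorem norm_unitaryGroup (hA : IsSelfAdjoint A) (hinj : Function.Injective A) (t : ℝ)
    (x : X) : ‖unitaryGroup A t x‖ = ‖x‖ := by
  refine le_antisymm (norm_unitaryGroup_le hA hinj t x) ?_
  conv_lhs => rw [← unitaryGroup_neg_apply hA hinj t x]
  exact norm_unitaryGroup_le hA hinj _ _

theorem inner_unitaryGroup (hA : IsSelfAdjoint A) (hinj : Function.Injective A) (t : ℝ)
    (x y : X) : inner ℂ (unitaryGroup A t x) (unitaryGroup A t y) = inner ℂ x y :=
  LinearIsometry.inner_map_map
    (⟨(unitaryGroup A t : X →ₗ[ℂ] X), norm_unitaryGroup hA hinj t⟩ : X →ₗᵢ[ℂ] X) x y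

theorem continuous_unitaryGroup (hA : IsSelfAdjoint A) (hinj : Function.Injective A) :
    Continuous fun q : ℝ × X => unitaryGroup A q.1 q.2 := by
  suffices hswap : Continuous fun q : X × ℝ => unitaryGroup A q.2 q.1 from
    Continuous.comp (g := fun q : X × ℝ => unitaryGroup A q.2 q.1)
      (f := fun q : ℝ × X => (q.2, q.1)) hswap (by fun_prop)
  refine continuous_prod_of_dense_continuous_lipschitzWith _ 1
    (denseRange_of_injective hA hinj) ?_ fun t => ?_
  · rintro _ ⟨y, rfl⟩
    simp only [unitaryGroup_apply_range hA hinj]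
    refine (LipschitzWith.of_dist_le_mul (K := ‖y‖₊) fun s t => ?_).continuous
    rw [dist_eq_norm, dist_eq_norm, ← sub_apply, mul_comm]
    exact ((smoothedGroup A s - smoothedGroup A t).le_opNorm y).trans
      (mul_le_mul_of_nonneg_right (norm_smoothedGroup_sub_le hA s t) (norm_nonneg _))
  · refine LipschitzWith.of_dist_le_mul fun x y => ?_
    rw [dist_eq_norm, dist_eq_norm, ← map_sub, NNReal.coe_one, one_mul]
    exact norm_unitaryGroup_le hA hinj _ _

theorem hasDerivAt_unitaryGroup (hA : IsSelfAdjoint A) (hinj : Function.Injective A) (x : X)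
    (t : ℝ) : HasDerivAt (fun s => A (unitaryGroup A s x)) (-Complex.I • unitaryGroup A t x) t := by
  -- On the range of `A` this is `hasDerivAt_mul_smoothedGroup`; the derivatives of an
  -- approximating sequence converge uniformly in time because the group is isometric.
  obtain ⟨y, hy, hlim⟩ := mem_closure_iff_seq_limit.1 (denseRange_of_injective hA hinj x)
  choose z hz using hy
  have hU : ∀ s, Filter.Tendsto (fun n => unitaryGroup A s (y n)) Filter.atTop
      (nhds (unitaryGroup A s x)) := fun s => ((unitaryGroup A s).continuous.tendsto x).comp hlim
  refine hasDerivAt_of_tendstoUniformly (l := Filter.atTop)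
    (f := fun n s => A (unitaryGroup A s (y n)))
    (f' := fun n s => -Complex.I • unitaryGroup A s (y n))
    (g' := fun s => -Complex.I • unitaryGroup A s x) ?_ (.of_forall fun n s => ?_)
    (fun s => (A.continuous.tendsto _).comp (hU s)) t
  · rw [Metric.tendstoUniformly_iff]
    intro ε hε
    filter_upwards [Metric.tendsto_nhds.1 hlim ε hε] with n hn s
    rwa [dist_eq_norm, ← smul_sub, ← map_sub, norm_smul, norm_unitaryGroup hA hinj, norm_neg,
      Complex.norm_I, one_mul, ← dist_eq_norm, dist_comm]
  · rw [← hz n]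
    simp only [unitaryGroup_apply_range hA hinj]
    exact (((ContinuousLinearMap.apply ℂ X (z n)).restrictScalars ℝ).hasFDerivAt
      (x := A * smoothedGroup A s)).comp_hasDerivAt s (hasDerivAt_mul_smoothedGroup hA s)

end UnitaryGroup

attribute [irreducible] unitaryGroup smoothedGroup

/-! ### Global solvability, truncation and continuation -/

section ODE

variable {E : Type*} [NormedAddCommGroup E] [NormedSpace ℝ E] [CompleteSpace E]
  {f : ℝ → E → E} {K L : NNReal}

theorem exists_hasDerivAt_Ioo_of_lipschitz_of_bounded (hf : ∀ t, LipschitzWith K (f t))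
    (hc : ∀ x, Continuous fun t => f t x) (hb : ∀ t x, ‖f t x‖ ≤ L) (x₀ : E) (a : NNReal) :
    ∃ α : ℝ → E, α 0 = x₀ ∧ ∀ t ∈ Set.Ioo (-a : ℝ) a, HasDerivAt α (f t (α t)) t := by
  have h0 : (0 : ℝ) ∈ Set.Icc (-a : ℝ) a := ⟨neg_nonpos.2 a.2, a.2⟩
  have hpl : IsPicardLindelof f (⟨0, h0⟩ : Set.Icc (-a : ℝ) a) x₀ (L * a) 0 L K :=
    { lipschitzOnWith := fun t _ => (hf t).lipschitzOnWith
      continuousOn := fun x _ => (hc x).continuousOn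
      norm_le := fun t _ x _ => hb t x
      mul_max_le := by simp }
  obtain ⟨α, hα0, hα⟩ := hpl.exists_eq_forall_mem_Icc_hasDerivWithinAt₀
  exact ⟨α, hα0, fun t ht => (hα t (Set.Ioo_subset_Icc_self ht)).hasDerivAt
    (Icc_mem_nhds ht.1 ht.2)⟩

theorem exists_hasDerivAt_of_lipschitz_of_bounded (hf : ∀ t, LipschitzWith K (f t))
    (hc : ∀ x, Continuous fun t => f t x) (hb : ∀ t x, ‖f t x‖ ≤ L) (x₀ : E) :
    ∃ α : ℝ → E, α 0 = x₀ ∧ ∀ t, HasDerivAt α (f t (α t)) t := by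
  choose α hα0 hα using fun n : ℕ =>
    exists_hasDerivAt_Ioo_of_lipschitz_of_bounded hf hc hb x₀ (n + 1)
  push_cast at hα
  have hagree : ∀ m n : ℕ, m ≤ n → ∀ t : ℝ, |t| < m + 1 → α m t = α n t := by
    intro m n hmn t ht
    have hmn' : (m : ℝ) ≤ n := by exact_mod_cast hmn
    exact ODE_solution_unique_of_mem_Ioo (v := f) (s := fun _ => Set.univ) (K := K)
      (t₀ := 0) (a := -(m + 1 : ℝ)) (b := m + 1) (fun t _ => (hf t).lipschitzOnWith)
      ⟨by linarith [m.cast_nonneg (α := ℝ)], by linarith [m.cast_nonneg (α := ℝ)]⟩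
      (fun t ht => ⟨hα m t ht, trivial⟩)
      (fun t ht => ⟨hα n t ⟨by linarith [ht.1], by linarith [ht.2]⟩, trivial⟩)
      ((hα0 m).trans (hα0 n).symm) (abs_lt.1 ht)
  refine ⟨fun t => α ⌈|t|⌉₊ t, hα0 _, fun t => ?_⟩
  obtain ⟨N, hN⟩ := exists_nat_gt |t|
  have hev : (fun s => α ⌈|s|⌉₊ s) =ᶠ[nhds t] α N := by
    filter_upwards [(continuous_abs.tendsto t).eventually (gt_mem_nhds hN)] with s hs
    exact hagree _ _ (Nat.ceil_le.2 hs.le) s (by linarith [Nat.le_ceil |s|])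
  have hderiv := (hα N t (abs_lt.1 (by linarith))).congr_of_eventuallyEq hev
  rwa [← hev.eq_of_nhds] at hderiv

end ODE

section Truncation

variable {X : Type*} [NormedAddCommGroup X] [NormedSpace ℝ X] {R : ℝ}

/-- The radial retraction onto the ball of radius `R > 0`, used to make a nonlinearity that is
Lipschitz on this ball globally Lipschitz. -/
def trunc (R : ℝ) (u : X) : X := (R / max R ‖u‖) • u

theorem trunc_of_norm_le (hR : 0 < R) {u : X} (hu : ‖u‖ ≤ R) : trunc R u = u := by
  rw [trunc, max_eq_left hu, div_self hR.ne', one_smul]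

theorem trunc_mem_closedBall (hR : 0 < R) (u : X) : trunc R u ∈ Metric.closedBall 0 R := by
  have hmax : 0 < max R ‖u‖ := lt_max_of_lt_left hR
  rw [mem_closedBall_zero_iff, trunc, norm_smul, Real.norm_eq_abs, abs_of_pos (div_pos hR hmax),
    div_mul_eq_mul_div, div_le_iff₀ hmax]
  exact mul_le_mul_of_nonneg_left (le_max_right _ _) hR.le

theorem lipschitzWith_trunc (hR : 0 < R) : LipschitzWith 2 (trunc R : X → X) := by
  refine LipschitzWith.of_dist_le_mul fun u v => ?_
  rw [dist_eq_norm, dist_eq_norm]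
  have hu : 0 < max R ‖u‖ := lt_max_of_lt_left hR
  have hv : 0 < max R ‖v‖ := lt_max_of_lt_left hR
  have hscale : |R / max R ‖u‖| ≤ 1 := by
    rw [abs_of_pos (div_pos hR hu)]
    exact (div_le_one hu).2 (le_max_left _ _)
  have hmax : |max R ‖v‖ - max R ‖u‖| ≤ ‖u - v‖ := by
    rw [max_comm R, max_comm R, norm_sub_rev]
    exact (abs_max_sub_max_le_abs _ _ _).trans (abs_norm_sub_norm_le v u)
  have hscale_sub : |R / max R ‖u‖ - R / max R ‖v‖| * ‖v‖ ≤ ‖u - v‖ := calc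
    _ = |R / max R ‖u‖| * |max R ‖v‖ - max R ‖u‖| * (‖v‖ / max R ‖v‖) := by
      rw [show R / max R ‖u‖ - R / max R ‖v‖ =
        R / max R ‖u‖ * (max R ‖v‖ - max R ‖u‖) / max R ‖v‖ by field_simp, abs_div, abs_mul,
        abs_of_pos hv, div_mul_eq_mul_div, mul_div_assoc]
    _ ≤ 1 * ‖u - v‖ * 1 := by
      gcongr
      exact (div_le_one hv).2 (le_max_right _ _)
    _ = ‖u - v‖ := by ring
  calc ‖trunc R u - trunc R v‖
      = ‖(R / max R ‖u‖) • (u - v) + (R / max R ‖u‖ - R / max R ‖v‖) • v‖ := by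
        rw [trunc, trunc, smul_sub, sub_smul, sub_add_sub_cancel]
    _ ≤ |R / max R ‖u‖| * ‖u - v‖ + |R / max R ‖u‖ - R / max R ‖v‖| * ‖v‖ := by
        refine (norm_add_le _ _).trans_eq ?_
        rw [norm_smul, norm_smul, Real.norm_eq_abs, Real.norm_eq_abs]
    _ ≤ 1 * ‖u - v‖ + ‖u - v‖ := by gcongr
    _ = 2 * ‖u - v‖ := by ring

variable {Y : Type*} [NormedAddCommGroup Y] {K : NNReal} {G : X → Y}

theorem lipschitzWith_comp_trunc (hR : 0 < R)
    (hG : LipschitzOnWith K G (Metric.closedBall 0 R)) :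
    LipschitzWith (K * 2) (G ∘ trunc R) := by
  rw [← lipschitzOnWith_univ]
  exact hG.comp (lipschitzWith_trunc hR).lipschitzOnWith fun u _ => trunc_mem_closedBall hR u

theorem norm_comp_trunc_le (hR : 0 < R) (hG : LipschitzOnWith K G (Metric.closedBall 0 R))
    (u : X) : ‖(G ∘ trunc R) u‖ ≤ ‖G 0‖ + K * R := by
  have hdist := hG.norm_sub_le (trunc_mem_closedBall hR u) (Metric.mem_closedBall_self hR.le)
  rw [sub_zero] at hdist
  exact (norm_le_norm_add_norm_sub' _ _).trans (add_le_add_right (hdist.trans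
    (mul_le_mul_of_nonneg_left (mem_closedBall_zero_iff.1 (trunc_mem_closedBall hR u)) K.2)) _)

end Truncation

theorem forall_le_of_bootstrap {f : ℝ → ℝ} (hf : Continuous f) {R c : ℝ} (hcR : c < R)
    (h0 : f 0 ≤ R) (h : ∀ T, 0 ≤ T → (∀ t ∈ Set.Icc 0 T, f t ≤ R) → f T ≤ c) :
    ∀ t, 0 ≤ t → f t ≤ c := by
  intro τ hτ
  by_contra! hcτ
  have hf0 : f 0 ≤ c := h 0 le_rfl fun t ht => by rwa [le_antisymm ht.2 ht.1]
  -- The first time `T` at which `f` takes a value `v` strictly above `c` but not above `R`.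
  obtain ⟨v, hcv, hvR, hvτ⟩ : ∃ v, c < v ∧ v ≤ R ∧ v ≤ f τ :=
    ⟨min R (f τ), lt_min hcR hcτ, min_le_left _ _, min_le_right _ _⟩
  have hhit : ∀ y, 0 ≤ y → v ≤ f y → (Set.Icc 0 y ∩ f ⁻¹' {v}).Nonempty := fun y hy hvy => by
    obtain ⟨z, hz, hfz⟩ := intermediate_value_Icc hy hf.continuousOn ⟨hf0.trans hcv.le, hvy⟩
    exact ⟨z, hz, hfz⟩
  obtain ⟨T, ⟨hT, hfT⟩, hfirst⟩ :=
    (isCompact_Icc.inter_right (isClosed_singleton.preimage hf)).exists_isLeast (hhit τ hτ hvτ)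
  refine (h T hT.1 fun t ht => ?_).not_gt (hcv.trans_eq hfT.symm)
  by_contra! hRt
  obtain ⟨z, hz, hfz⟩ := hhit t ht.1 (hvR.trans hRt.le)
  have hTt : T = t := le_antisymm
    ((hfirst ⟨⟨hz.1, hz.2.trans (ht.2.trans hT.2)⟩, hfz⟩).trans hz.2) ht.2
  rw [← hTt, show f T = v from hfT] at hRt
  exact hvR.not_gt hRt

theorem forall_le_of_bootstrap_uIcc {f : ℝ → ℝ} (hf : Continuous f) {R c : ℝ} (hcR : c < R)
    (h0 : f 0 ≤ R) (h : ∀ T, (∀ t ∈ Set.uIcc 0 T, f t ≤ R) → f T ≤ c) (t : ℝ) : f t ≤ c := by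
  rcases le_total 0 t with ht | ht
  · refine forall_le_of_bootstrap hf hcR h0 (fun T hT hle => h T ?_) t ht
    rwa [Set.uIcc_of_le hT]
  · rw [← neg_neg t]
    refine forall_le_of_bootstrap (f := fun s => f (-s)) (hf.comp continuous_neg) hcR
      (by rwa [neg_zero]) (fun T hT hle => h (-T) fun s hs => ?_) (-t) (neg_nonneg.2 ht)
    rw [Set.uIcc_of_ge (neg_nonpos.2 hT)] at hs
    rw [← neg_neg s]
    exact hle (-s) ⟨neg_nonneg.2 hs.2, neg_le.1 hs.1⟩

theorem eq_zero_of_norm_deriv_le_mul_norm {E : Type*} [NormedAddCommGroup E] [NormedSpace ℝ E]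
    {f f' : ℝ → E} {K : ℝ} (hf : ∀ t, HasDerivAt f (f' t) t) (hf' : ∀ t, ‖f' t‖ ≤ K * ‖f t‖)
    (h0 : f 0 = 0) (t : ℝ) : f t = 0 := by
  have hright : ∀ {g g' : ℝ → E}, (∀ s, HasDerivAt g (g' s) s) → (∀ s, ‖g' s‖ ≤ K * ‖g s‖) →
      g 0 = 0 → ∀ s, 0 ≤ s → g s = 0 := fun hg hg' hg0 s hs =>
    eq_zero_of_abs_deriv_le_mul_abs_self_of_eq_zero_right
      (fun r _ => (hg r).continuousAt.continuousWithinAt) (fun r _ => (hg r).hasDerivWithinAt)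
      hg0 (fun r _ => hg' r) s ⟨hs, le_rfl⟩
  rcases le_total 0 t with ht | ht
  · exact hright hf hf' h0 t ht
  · rw [← neg_neg t]
    refine hright (g := fun s => f (-s)) (g' := fun s => -f' (-s)) (fun s => ?_)
      (fun s => ?_) (by rwa [neg_zero]) (-t) (neg_nonneg.2 ht)
    · simpa only [Function.comp_def, neg_smul, one_smul] using (hf (-s)).scomp s (hasDerivAt_neg s)
    · rw [norm_neg]
      exact hf' (-s)

/-! ### The abstract semilinear Schrödinger equation -/

theorem re_neg_I_mul (z : ℂ) : (-Complex.I * z).re = z.im := by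
  rw [neg_mul, Complex.neg_re, Complex.I_mul_re, neg_neg]

section Evolution

variable {X : Type*} [NormedAddCommGroup X] [InnerProductSpace ℂ X]

theorem hasDerivAt_comp_of_isBigO {A : X →L[ℂ] X} {P : X → ℝ} {g d : X} {w : ℝ → X} {t : ℝ}
    (hP : (fun b => P b - P (w t) - (inner ℂ g (A (b - w t))).re) =O[nhds (w t)]
      fun b => ‖b - w t‖ * ‖A (b - w t)‖)
    (hw : ContinuousAt w t) (hd : HasDerivAt (fun s => A (w s)) d t) :
    HasDerivAt (fun s => P (w s)) (inner ℂ g d).re t := by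
  have hlinear : HasDerivAt (fun s => (inner ℂ g (A (w s))).re) (inner ℂ g d).re t :=
    (Complex.reCLM.comp ((innerSL ℂ g).restrictScalars ℝ)).hasFDerivAt.comp_hasDerivAt t hd
  have hw0 : (fun s => ‖w s - w t‖) =o[nhds t] fun _ => (1 : ℝ) := by
    rw [Asymptotics.isLittleO_one_iff]
    exact tendsto_iff_norm_sub_tendsto_zero.1 hw
  have hAw : (fun s => ‖A (w s - w t)‖) =O[nhds t] fun s => s - t := by
    simpa only [map_sub] using hd.isBigO_sub.norm_left
  have hrem := (hP.comp_tendsto hw.tendsto).trans_isLittleO (hw0.mul_isBigO hAw)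
  rw [hasDerivAt_iff_isLittleO] at hlinear ⊢
  refine (hrem.add (hlinear.congr_right fun s => (one_mul (s - t)).symm)).congr (fun s => ?_)
    fun s => one_mul (s - t)
  simp only [Function.comp_apply, map_sub, inner_sub_right, Complex.sub_re]
  ring

theorem hasDerivAt_re_inner_apply {A : X →L[ℂ] X}
    (hA : ∀ x y, inner ℂ (A x) y = inner ℂ x (A y)) {d : X} {w : ℝ → X} {t : ℝ}
    (hw : ContinuousAt w t) (hd : HasDerivAt (fun s => A (w s)) d t) :
    HasDerivAt (fun s => (inner ℂ (w s) (A (w s))).re) (2 * (inner ℂ (w t) d).re) t := by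
  have hquad : ∀ a b : X, (inner ℂ b (A b)).re - (inner ℂ a (A a)).re -
      (inner ℂ ((2 : ℂ) • a) (A (b - a))).re = (inner ℂ (b - a) (A (b - a))).re := fun a b => by
    have hsymm : (inner ℂ b (A a)).re = (inner ℂ a (A b)).re := by
      rw [← hA, ← inner_conj_symm, Complex.conj_re]
    simp only [map_sub, inner_sub_left, inner_sub_right, Complex.sub_re, inner_smul_left,
      map_ofNat, Complex.mul_re, Complex.re_ofNat, Complex.im_ofNat, hsymm]
    ring
  refine (hasDerivAt_comp_of_isBigO (P := fun x => (inner ℂ x (A x)).re)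
    (g := (2 : ℂ) • w t) (.of_bound 1 (.of_forall fun b => ?_)) hw hd).congr_deriv ?_
  · rw [hquad, one_mul, norm_mul, norm_norm, norm_norm, Real.norm_eq_abs]
    exact (Complex.abs_re_le_norm _).trans (norm_inner_le_norm _ _)
  · rw [inner_smul_left, map_ofNat, Complex.mul_re, Complex.re_ofNat, Complex.im_ofNat, zero_mul,
      sub_zero]

/-- `u` is a continuous global solution of `i ∂ₜ(A u) = u + A G(u)`. This is the semilinear
equation `i ∂ₜu = A⁻¹ u + G(u)` for a possibly unbounded operator `A⁻¹`, with `A` applied to both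
sides so that only bounded operators occur. -/
structure SolvesEvolution (A : X →L[ℂ] X) (G : X → X) (u : ℝ → X) : Prop where
  continuous : Continuous u
  hasDerivAt : ∀ t, HasDerivAt (fun s => A (u s)) (-Complex.I • (u t + A (G (u t)))) t

variable [CompleteSpace X] {A : X →L[ℂ] X}

theorem hasDerivAt_unitaryGroup_comp (hA : IsSelfAdjoint A) (hinj : Function.Injective A)
    {α : ℝ → X} {α' : X} {t : ℝ} (hα : HasDerivAt α α' t) :
    HasDerivAt (fun s => A (unitaryGroup A s (α s)))
      (-Complex.I • unitaryGroup A t (α t) + A (unitaryGroup A t α')) t := by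
  have hgroup := hasDerivAt_unitaryGroup hA hinj (α t) t
  rw [hasDerivAt_iff_tendsto_slope] at hgroup hα ⊢
  have hcurve : Filter.Tendsto (fun s => A (unitaryGroup A s (slope α t s)))
      (nhdsWithin t {t}ᶜ) (nhds (A (unitaryGroup A t α'))) :=
    (A.continuous.tendsto _).comp (((continuous_unitaryGroup hA hinj).tendsto (t, α')).comp
      ((tendsto_nhdsWithin_of_tendsto_nhds Filter.tendsto_id).prodMk_nhds hα))
  refine (hgroup.add hcurve).congr fun s => ?_
  rw [slope_def_module, slope_def_module, slope_def_module, ← Complex.coe_smul,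
    ← Complex.coe_smul, ← Complex.coe_smul, map_smul, map_smul, map_sub, map_sub, ← smul_add,
    add_comm, sub_add_sub_cancel]

theorem exists_interaction_curve (hA : IsSelfAdjoint A) (hinj : Function.Injective A) {F : X → X}
    {K L : NNReal} (hF : LipschitzWith K F) (hb : ∀ u, ‖F u‖ ≤ L) (u₀ : X) :
    ∃ α : ℝ → X, α 0 = u₀ ∧
      ∀ t, HasDerivAt α (-Complex.I • unitaryGroup A (-t) (F (unitaryGroup A t (α t)))) t := by
  have hU := norm_unitaryGroup hA hinj
  refine exists_hasDerivAt_of_lipschitz_of_bounded (K := K) (L := L)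
    (f := fun t v => -Complex.I • unitaryGroup A (-t) (F (unitaryGroup A t v)))
    (fun t => LipschitzWith.of_dist_le_mul fun u v => ?_) (fun x => ?_) (fun t x => ?_) u₀
  · rw [dist_eq_norm, dist_eq_norm, ← smul_sub, ← map_sub, norm_smul, norm_neg, Complex.norm_I,
      one_mul, hU, ← hU t (u - v), map_sub]
    exact hF.norm_sub_le _ _
  · have hinner := hF.continuous.comp
      ((continuous_unitaryGroup hA hinj).comp (continuous_id.prodMk (continuous_const (y := x))))
    exact ((continuous_unitaryGroup hA hinj).comp
      (continuous_neg.prodMk hinner)).const_smul (-Complex.I)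
  · rw [norm_smul, norm_neg, Complex.norm_I, one_mul, hU]
    exact hb _

theorem exists_solvesEvolution_of_lipschitz_of_bounded (hA : IsSelfAdjoint A)
    (hinj : Function.Injective A) {F : X → X} {K L : NNReal} (hF : LipschitzWith K F)
    (hb : ∀ u, ‖F u‖ ≤ L) (u₀ : X) :
    ∃ u : ℝ → X, SolvesEvolution A F u ∧ u 0 = u₀ ∧
      ∀ t, HasDerivAt (fun s => ‖u s‖ ^ 2) (2 * (inner ℂ (u t) (F (u t))).im) t := by
  obtain ⟨α, hα0, hα⟩ := exists_interaction_curve hA hinj hF hb u₀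
  have hαc : Continuous α := continuous_iff_continuousAt.2 fun t => (hα t).continuousAt
  refine ⟨fun t => unitaryGroup A t (α t), ⟨?_, fun t => ?_⟩, ?_, fun t => ?_⟩
  · exact (continuous_unitaryGroup hA hinj).comp (continuous_id.prodMk hαc)
  · convert hasDerivAt_unitaryGroup_comp hA hinj (hα t) using 1
    rw [map_smul, unitaryGroup_apply_neg hA hinj, map_smul, smul_add]
  · simp only [hα0, unitaryGroup_zero hA hinj]
  · simp only [norm_unitaryGroup hA hinj]
    have hinner : (inner ℂ (unitaryGroup A t (α t)) (F (unitaryGroup A t (α t)))).im =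
        (inner ℂ (α t) (-Complex.I • unitaryGroup A (-t) (F (unitaryGroup A t (α t))))).re := by
      rw [inner_smul_right, re_neg_I_mul, ← inner_unitaryGroup hA hinj t (α t),
        unitaryGroup_apply_neg hA hinj]
    rw [hinner]
    convert hasDerivAt_re_inner_apply (A := .id ℂ X) (fun _ _ => rfl) hαc.continuousAt (hα t)
      using 2 with s
    exact (inner_self_eq_norm_sq (𝕜 := ℂ) (α s)).symm

end Evolution

/-! ### Well-posedness from conservation of mass and energy -/

section Gram

variable {X Y : Type*} [NormedAddCommGroup X] [InnerProductSpace ℂ X] [CompleteSpace X]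
  [NormedAddCommGroup Y] [InnerProductSpace ℂ Y] [CompleteSpace Y]

/-- The operator `J* J` of an embedding `J : X → Y` of Hilbert spaces. It is the inverse, on `X`,
of the self-adjoint operator of `Y` whose quadratic form is `u ↦ ‖u‖²` with form domain `X`. -/
def gram (J : X →L[ℂ] Y) : X →L[ℂ] X := (ContinuousLinearMap.adjoint J).comp J

theorem inner_gram_right (J : X →L[ℂ] Y) (x y : X) :
    inner ℂ x (gram J y) = inner ℂ (J x) (J y) :=
  ContinuousLinearMap.adjoint_inner_right J x (J y)

theorem inner_gram_left (J : X →L[ℂ] Y) (x y : X) :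
    inner ℂ (gram J x) y = inner ℂ (J x) (J y) :=
  ContinuousLinearMap.adjoint_inner_left J y (J x)

theorem inner_gram_symm (J : X →L[ℂ] Y) (x y : X) :
    inner ℂ (gram J x) y = inner ℂ x (gram J y) := by
  rw [inner_gram_left, inner_gram_right]

theorem isSelfAdjoint_gram (J : X →L[ℂ] Y) : IsSelfAdjoint (gram J) :=
  ContinuousLinearMap.isSelfAdjoint_iff_isSymmetric.2 (inner_gram_symm J)

theorem re_inner_gram_self (J : X →L[ℂ] Y) (x : X) : (inner ℂ x (gram J x)).re = ‖J x‖ ^ 2 := by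
  rw [inner_gram_right]
  exact inner_self_eq_norm_sq (𝕜 := ℂ) (J x)

theorem norm_sq_apply_le (J : X →L[ℂ] Y) (x : X) : ‖J x‖ ^ 2 ≤ ‖x‖ * ‖gram J x‖ := by
  rw [← re_inner_gram_self]
  exact (Complex.re_le_norm _).trans (norm_inner_le_norm _ _)

theorem gram_injective {J : X →L[ℂ] Y} (hJ : Function.Injective J) :
    Function.Injective (gram J) := by
  refine (injective_iff_map_eq_zero _).2 fun x hx => (map_eq_zero_iff J hJ).1 ?_
  have hle := norm_sq_apply_le J x
  rw [hx, norm_zero, mul_zero] at hle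
  exact norm_eq_zero.1 (sq_nonpos_iff _ |>.1 hle)

variable {J : X →L[ℂ] Y}

theorem hasDerivAt_mass {g : X} {w : ℝ → X} {t : ℝ} (hw : ContinuousAt w t)
    (hd : HasDerivAt (fun s => gram J (w s)) (-Complex.I • (w t + gram J g)) t) :
    HasDerivAt (fun s => ‖J (w s)‖ ^ 2) (2 * (inner ℂ (J (w t)) (J g)).im) t := by
  have hself : (inner ℂ (w t) (w t)).im = 0 := inner_self_im (𝕜 := ℂ) (w t)
  have hderiv := hasDerivAt_re_inner_apply (inner_gram_symm J) hw hd
  simp only [re_inner_gram_self] at hderiv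
  rwa [inner_smul_right, re_neg_I_mul, inner_add_right, Complex.add_im, hself, zero_add,
    inner_gram_right] at hderiv

theorem hasDerivAt_energy {P : X → ℝ} {g : X} {w : ℝ → X} {t : ℝ} (hw : ContinuousAt w t)
    (hd : HasDerivAt (fun s => gram J (w s)) (-Complex.I • (w t + gram J g)) t)
    (hn : HasDerivAt (fun s => ‖w s‖ ^ 2) (2 * (inner ℂ (w t) g).im) t)
    (hP : (fun b => P b - P (w t) - (inner ℂ (J g) (J (b - w t))).re) =O[nhds (w t)]
      fun b => ‖J (b - w t)‖ ^ 2) :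
    HasDerivAt (fun s => 1 / 2 * ‖w s‖ ^ 2 + P (w s)) 0 t := by
  have hPd := hasDerivAt_comp_of_isBigO (A := gram J) (P := P) (g := g)
    (by
      simp only [inner_gram_right]
      refine hP.trans (.of_norm_le fun b => ?_)
      rw [norm_pow, norm_norm]
      exact norm_sq_apply_le J _) hw hd
  refine ((hn.const_mul (1 / 2)).add hPd).congr_deriv ?_
  have hself : (inner ℂ (J g) (J g)).im = 0 := inner_self_im (𝕜 := ℂ) (J g)
  rw [inner_smul_right, re_neg_I_mul, inner_add_right, Complex.add_im, inner_gram_right, hself,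
    ← inner_conj_symm, Complex.conj_im]
  ring

theorem SolvesEvolution.eq_of_norm_apply_sub_le (hJ : Function.Injective J) {G : X → X} {K : ℝ}
    {u v : ℝ → X} (hu : SolvesEvolution (gram J) G u) (hv : SolvesEvolution (gram J) G v)
    (hG : ∀ t, ‖J (G (u t) - G (v t))‖ ≤ K * ‖J (u t - v t)‖) (h0 : u 0 = v 0) : u = v := by
  have hmass : ∀ t, HasDerivAt (fun s => ‖J (u s - v s)‖ ^ 2)
      (2 * (inner ℂ (J (u t - v t)) (J (G (u t) - G (v t)))).im) t := fun t => by
    refine hasDerivAt_mass (hu.continuous.sub hv.continuous).continuousAt ?_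
    have hsub := (hu.hasDerivAt t).fun_sub (hv.hasDerivAt t)
    rw [← smul_sub, add_sub_add_comm, ← map_sub] at hsub
    simpa only [map_sub] using hsub
  have hgrowth : ∀ t, ‖2 * (inner ℂ (J (u t - v t)) (J (G (u t) - G (v t)))).im‖ ≤
      2 * K * ‖‖J (u t - v t)‖ ^ 2‖ := fun t => calc
    _ ≤ 2 * (‖J (u t - v t)‖ * ‖J (G (u t) - G (v t))‖) := by
      rw [norm_mul, Real.norm_eq_abs, Real.norm_eq_abs, abs_two]
      gcongr
      exact (Complex.abs_im_le_norm _).trans (norm_inner_le_norm _ _)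
    _ ≤ 2 * (‖J (u t - v t)‖ * (K * ‖J (u t - v t)‖)) := by gcongr; exact hG t
    _ = 2 * K * ‖‖J (u t - v t)‖ ^ 2‖ := by rw [norm_pow, norm_norm]; ring
  funext t
  have hzero := eq_zero_of_norm_deriv_le_mul_norm hmass hgrowth
    (by rw [h0, sub_self, map_zero, norm_zero, zero_pow two_ne_zero]) t
  rw [sq_eq_zero_iff, norm_eq_zero, map_eq_zero_iff J hJ] at hzero
  exact sub_eq_zero.1 hzero

end Gram

theorem norm_le_of_conserved {X : Type*} [NormedAddCommGroup X] {E : X → ℝ} {R C : ℝ}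
    (hC : 0 < C) (hE : ∀ x, ‖x‖ ≤ R → C⁻¹ * ‖x‖ ^ 2 ≤ E x ∧ E x ≤ C * ‖x‖ ^ 2) {u : ℝ → X}
    (hu : Continuous u) (hEu : ∀ t, ‖u t‖ ≤ R → HasDerivAt (fun s => E (u s)) 0 t)
    (h0 : ‖u 0‖ ≤ R) (hC0 : C * ‖u 0‖ < R) (t : ℝ) : ‖u t‖ ≤ C * ‖u 0‖ := by
  refine forall_le_of_bootstrap_uIcc hu.norm hC0 h0 (fun T hT => ?_) t
  have hconst : E (u T) = E (u 0) := by
    have hsub := (convex_uIcc 0 T).norm_image_sub_le_of_norm_hasDerivWithin_le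
      (fun t ht => (hEu t (hT t ht)).hasDerivWithinAt) (fun _ _ => norm_zero.le)
      Set.left_mem_uIcc Set.right_mem_uIcc
    rwa [zero_mul, norm_le_zero_iff, sub_eq_zero] at hsub
  have hsq : C⁻¹ * ‖u T‖ ^ 2 ≤ C * ‖u 0‖ ^ 2 :=
    (hE _ (hT T Set.right_mem_uIcc)).1.trans (hconst.trans_le (hE _ h0).2)
  rw [inv_mul_le_iff₀ hC, ← mul_assoc, ← sq, ← mul_pow] at hsq
  exact (sq_le_sq₀ (norm_nonneg _) (by positivity)).1 hsq

section GlobalExistence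

variable {X Y : Type*} [NormedAddCommGroup X] [InnerProductSpace ℂ X] [CompleteSpace X]
  [NormedAddCommGroup Y] [InnerProductSpace ℂ Y] [CompleteSpace Y]

theorem exists_solvesEvolution_of_coercive {J : X →L[ℂ] Y} (hJ : Function.Injective J)
    {G : X → X} {P : X → ℝ} {K : NNReal} {R C κ : ℝ} (hR : 0 < R) (hC : 0 < C)
    (hG : LipschitzOnWith K G (Metric.closedBall 0 R))
    (hGim : ∀ u, (inner ℂ (J u) (J (G u))).im = 0)
    (hP : ∀ a, (fun b => P b - P a - (inner ℂ (J (G a)) (J (b - a))).re) =O[nhds a]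
      fun b => ‖J (b - a)‖ ^ 2)
    (hco : ∀ u, ‖u‖ ≤ R → C⁻¹ * ‖u‖ ^ 2 ≤ 1 / 2 * ‖u‖ ^ 2 + P u + κ * ‖J u‖ ^ 2 ∧
      1 / 2 * ‖u‖ ^ 2 + P u + κ * ‖J u‖ ^ 2 ≤ C * ‖u‖ ^ 2)
    {u₀ : X} (hu₀ : ‖u₀‖ ≤ R) (hCu₀ : C * ‖u₀‖ < R) :
    ∃ u : ℝ → X, SolvesEvolution (gram J) G u ∧ u 0 = u₀ ∧ ∀ t, ‖u t‖ ≤ C * ‖u₀‖ := by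
  obtain ⟨u, hu, rfl, hnorm⟩ := exists_solvesEvolution_of_lipschitz_of_bounded
    (L := ⟨‖G 0‖ + K * R, by positivity⟩) (isSelfAdjoint_gram J) (gram_injective hJ)
    (lipschitzWith_comp_trunc hR hG) (norm_comp_trunc_le hR hG) u₀
  have htrunc : ∀ t, ‖u t‖ ≤ R → (G ∘ trunc R) (u t) = G (u t) := fun t ht =>
    congrArg G (trunc_of_norm_le hR ht)
  have hconserved : ∀ t, ‖u t‖ ≤ R →
      HasDerivAt (fun s => 1 / 2 * ‖u s‖ ^ 2 + P (u s) + κ * ‖J (u s)‖ ^ 2) 0 t := fun t ht => by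
    have hd := hu.hasDerivAt t
    have hn := hnorm t
    rw [htrunc t ht] at hd hn
    refine ((hasDerivAt_energy hu.continuous.continuousAt hd hn (hP _)).add
      ((hasDerivAt_mass hu.continuous.continuousAt hd).const_mul κ)).congr_deriv ?_
    rw [hGim, mul_zero, mul_zero, add_zero]
  have hbound := norm_le_of_conserved hC hco hu.continuous hconserved hu₀ hCu₀
  refine ⟨u, ⟨hu.continuous, fun t => ?_⟩, rfl, hbound⟩
  rw [← htrunc t ((hbound t).trans hCu₀.le)]
  exact hu.hasDerivAt t

end GlobalExistence

/-! ### The Riesz isomorphism between `Ĥ¹` and `Ĥ⁻¹` -/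

theorem integral_mul_eq_inner (f g : L2) : ∫ x, f x * g x = inner ℂ (star g) f := by
  rw [MeasureTheory.L2.inner_def]
  refine integral_congr_ae ?_
  filter_upwards [L2.coeFn_star g] with x hx
  rw [hx, RCLike.inner_apply, Complex.conj_conj]

theorem integrable_mul_L2 (f g : L2) : Integrable fun x => f x * g x :=
  (Lp.memLp f).integrable_mul (Lp.memLp g)

theorem fn_injective : Function.Injective fn := fun _ _ h => Hhat1.ext_fn h

/-- The operator `-∂ₓₓ + x² + 2` from `Ĥ¹` to `Ĥ⁻¹`, defined by its bilinear form. Up to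
conjugation it is the Riesz isomorphism of `Ĥ¹`. -/
def rieszMap : Hhat1 →L[ℂ] HhatNeg1 :=
  toHhatNeg1 + ((ContinuousLinearMap.mul ℂ ℂ).lpPairing (volume : Measure ℝ) 2 2).bilinearComp dx dx
    + ((ContinuousLinearMap.mul ℂ ℂ).lpPairing (volume : Measure ℝ) 2 2).bilinearComp wt wt

theorem rieszMap_apply (u φ : Hhat1) : rieszMap u φ =
    (∫ x, fn u x * fn φ x) + (∫ x, dx u x * dx φ x) + ∫ x, wt u x * wt φ x := by
  have hpairing : ∀ f g : L2, (ContinuousLinearMap.mul ℂ ℂ).lpPairing (volume : Measure ℝ) 2 2 f g =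
      ∫ x, f x * g x := fun f g => ContinuousLinearMap.lpPairing_eq_integral _ _ _
  rw [← hpairing, ← hpairing, ← hpairing]
  rfl

theorem rieszMap_eq_inner (u φ : Hhat1) : rieszMap u φ = inner ℂ (Hhat1.conj φ) u := by
  rw [rieszMap_apply, Hhat1.inner_eq, integral_mul_eq_inner, integral_mul_eq_inner,
    integral_mul_eq_inner]
  rfl

theorem rieszMap_eq_toDual (u : Hhat1) :
    rieszMap u = InnerProductSpace.toDual ℂ Hhat1 (Hhat1.conj u) := by
  ext φ
  rw [InnerProductSpace.toDual_apply_apply, ← rieszMap_eq_inner, rieszMap_apply, rieszMap_apply]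
  simp only [mul_comm]

/-- `rieszMap` as an isometric isomorphism. -/
def rieszEquiv : Hhat1 ≃ₗᵢ[ℂ] HhatNeg1 :=
  LinearIsometryEquiv.ofSurjective
    (⟨(rieszMap : Hhat1 →ₗ[ℂ] HhatNeg1), fun u => by
      change ‖rieszMap u‖ = ‖u‖
      rw [rieszMap_eq_toDual, LinearIsometryEquiv.norm_map, Hhat1.norm_conj]⟩ :
        Hhat1 →ₗᵢ[ℂ] HhatNeg1)
    (fun ℓ => ⟨Hhat1.conj ((InnerProductSpace.toDual ℂ Hhat1).symm ℓ), by
      change rieszMap _ = ℓ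
      rw [rieszMap_eq_toDual, Hhat1.conj_conj, LinearIsometryEquiv.apply_symm_apply]⟩)

theorem toHhatNeg1_eq_rieszEquiv (u : Hhat1) : toHhatNeg1 u = rieszEquiv (gram fn u) := by
  change _ = rieszMap (gram fn u)
  ext φ
  rw [toHhatNeg1_apply, rieszMap_eq_inner, inner_gram_right, integral_mul_eq_inner]
  rfl

instance : ContinuousSMul ℝ HhatNeg1 :=
  ContinuousLinearMap.toNormedSpace.toIsBoundedSMul.continuousSMul

theorem hasDerivAt_continuousLinearEquiv_comp_iff {E F : Type*} [NormedAddCommGroup E]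
    [NormedSpace ℂ E] [NormedSpace ℝ E] [IsScalarTower ℝ ℂ E] [NormedAddCommGroup F]
    [NormedSpace ℂ F] [NormedSpace ℝ F] [IsScalarTower ℝ ℂ F] (e : E ≃L[ℂ] F) {f : ℝ → E} {w : E}
    {t : ℝ} : HasDerivAt (fun s => e (f s)) (e w) t ↔ HasDerivAt f w t := by
  refine ⟨fun h => ?_, ((e : E →L[ℂ] F).restrictScalars ℝ).hasFDerivAt.comp_hasDerivAt t⟩
  have hsymm := ((e.symm : F →L[ℂ] E).restrictScalars ℝ).hasFDerivAt.comp_hasDerivAt t h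
  simpa [Function.comp_def] using hsymm

theorem hasDerivAt_toHhatNeg1_iff {u : ℝ → Hhat1} {w : Hhat1} {t : ℝ} :
    HasDerivAt (fun s => toHhatNeg1 (u s)) (rieszEquiv w) t ↔
      HasDerivAt (fun s => gram fn (u s)) w t := by
  simp only [toHhatNeg1_eq_rieszEquiv]
  exact hasDerivAt_continuousLinearEquiv_comp_iff (F := HhatNeg1)
    rieszEquiv.toContinuousLinearEquiv

/-! ### The nonlinearity -/

/-- The function `|u|^{2k} u`, built from the algebra structure of `Ĥ¹`. -/
def absPowMul : ℕ → Hhat1 → Hhat1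
  | 0, u => u
  | k + 1, u => Hhat1.mul (Hhat1.mul u (Hhat1.conj u)) (absPowMul k u)

theorem fn_absPowMul_ae (k : ℕ) (u : Hhat1) :
    ∀ᵐ x : ℝ, fn (absPowMul k u) x = ((‖fn u x‖ ^ (2 * k) : ℝ) : ℂ) * fn u x := by
  induction k with
  | zero => exact .of_forall fun x => by simp [absPowMul]
  | succ k ih =>
    filter_upwards [ih, Hhat1.fn_mul_ae (Hhat1.mul u (Hhat1.conj u)) (absPowMul k u),
      Hhat1.fn_mul_ae u (Hhat1.conj u), Hhat1.fn_conj_ae u] with x hk hmul habs hconj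
    rw [absPowMul, hmul, habs, hconj, hk, Complex.mul_conj']
    push_cast
    ring

theorem norm_mul_conj_self_le (u : Hhat1) : ‖Hhat1.mul u (Hhat1.conj u)‖ ≤ 8 * ‖u‖ ^ 2 := by
  refine (Hhat1.norm_mul_le _ _).trans_eq ?_
  rw [Hhat1.norm_conj]
  ring

theorem norm_absPowMul_le (k : ℕ) (u : Hhat1) : ‖absPowMul k u‖ ≤ (8 * ‖u‖) ^ (2 * k) * ‖u‖ := by
  induction k with
  | zero => simp [absPowMul]
  | succ k ih => calc
    ‖absPowMul (k + 1) u‖ ≤ 8 * (8 * ‖u‖ ^ 2) * ((8 * ‖u‖) ^ (2 * k) * ‖u‖) :=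
      (Hhat1.norm_mul_le _ _).trans (by gcongr; exact norm_mul_conj_self_le u)
    _ = (8 * ‖u‖) ^ (2 * (k + 1)) * ‖u‖ := by ring

theorem mul_conj_self_sub (u v : Hhat1) :
    Hhat1.mul u (Hhat1.conj u) - Hhat1.mul v (Hhat1.conj v) =
      Hhat1.mul (Hhat1.conj u) (u - v) + Hhat1.mul v (Hhat1.conj (u - v)) := by
  rw [Hhat1.mul_sub, Hhat1.conj_sub, Hhat1.mul_sub, Hhat1.mul_comm (Hhat1.conj u) u,
    Hhat1.mul_comm (Hhat1.conj u) v, sub_add_sub_cancel]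

theorem absPowMul_succ_sub (k : ℕ) (u v : Hhat1) :
    absPowMul (k + 1) u - absPowMul (k + 1) v =
      Hhat1.mul (Hhat1.mul u (Hhat1.conj u)) (absPowMul k u - absPowMul k v) +
      Hhat1.mul (absPowMul k v)
        (Hhat1.mul u (Hhat1.conj u) - Hhat1.mul v (Hhat1.conj v)) := by
  rw [Hhat1.mul_sub, Hhat1.mul_sub, Hhat1.mul_comm (absPowMul k v),
    Hhat1.mul_comm (absPowMul k v), sub_add_sub_cancel]
  rfl

/-- The nonlinearity `V u - 2 u + σ |u|^{2p} u`. The term `-2 u` is there because the squared norm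
of `Ĥ¹` is the quadratic form of `-∂ₓₓ + x² + 2`. -/
def nonlin (p : ℕ) (σ : ℝ) (V u : Hhat1) : Hhat1 :=
  Hhat1.mul V u - (2 : ℂ) • u + (σ : ℂ) • absPowMul p u

theorem fn_nonlin_ae (p : ℕ) (σ : ℝ) (V u : Hhat1) : ∀ᵐ x : ℝ, fn (nonlin p σ V u) x =
    (fn V x - 2 + σ * ((‖fn u x‖ ^ (2 * p) : ℝ) : ℂ)) * fn u x := by
  filter_upwards [fn_add_ae (Hhat1.mul V u - (2 : ℂ) • u) ((σ : ℂ) • absPowMul p u),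
    fn_sub_ae (Hhat1.mul V u) ((2 : ℂ) • u), fn_smul_ae 2 u, fn_smul_ae σ (absPowMul p u),
    fn_absPowMul_ae p u, Hhat1.fn_mul_ae V u] with x hadd hsub htwo hsmul hpow hmul
  rw [nonlin, hadd, hsub, htwo, hsmul, hpow, hmul]
  ring

theorem nonlin_sub (p : ℕ) (σ : ℝ) (V u v : Hhat1) :
    nonlin p σ V u - nonlin p σ V v = Hhat1.mul V (u - v) - (2 : ℂ) • (u - v) +
      (σ : ℂ) • (absPowMul p u - absPowMul p v) := by
  rw [nonlin, nonlin, Hhat1.mul_sub, smul_sub, smul_sub]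
  abel

section Seminorm

variable {ν : Seminorm ℂ Hhat1} {c : ℝ} (hc : 0 ≤ c)
  (hmul : ∀ a b, ν (Hhat1.mul a b) ≤ c * ‖a‖ * ν b) (hconj : ∀ a, ν (Hhat1.conj a) = ν a)

include hmul hconj in
theorem seminorm_mul_conj_self_sub_le (u v : Hhat1) :
    ν (Hhat1.mul u (Hhat1.conj u) - Hhat1.mul v (Hhat1.conj v)) ≤
      c * (‖u‖ + ‖v‖) * ν (u - v) := by
  have hu := hmul (Hhat1.conj u) (u - v)
  have hv := hmul v (Hhat1.conj (u - v))
  rw [Hhat1.norm_conj] at hu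
  rw [hconj] at hv
  rw [mul_conj_self_sub]
  linarith [map_add_le_add ν (Hhat1.mul (Hhat1.conj u) (u - v))
    (Hhat1.mul v (Hhat1.conj (u - v)))]

include hc hmul hconj in
theorem exists_seminorm_absPowMul_sub_le (k : ℕ) {M : ℝ} (hM : 0 ≤ M) :
    ∃ K : ℝ, 0 ≤ K ∧ ∀ u v : Hhat1, ‖u‖ ≤ M → ‖v‖ ≤ M →
      ν (absPowMul k u - absPowMul k v) ≤ K * ν (u - v) := by
  induction k with
  | zero => exact ⟨1, zero_le_one, fun u v _ _ => (one_mul (ν (u - v))).ge⟩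
  | succ k ih =>
    obtain ⟨K, hK, h⟩ := ih
    refine ⟨c * (8 * M ^ 2) * K + c * ((8 * M) ^ (2 * k) * M) * (c * (M + M)), by positivity,
      fun u v hu hv => ?_⟩
    rw [absPowMul_succ_sub, add_mul, mul_assoc _ K, mul_assoc (c * (_ * M))]
    refine (map_add_le_add ν _ _).trans (add_le_add ?_ ?_)
    · refine (hmul _ _).trans ?_
      gcongr
      · exact (norm_mul_conj_self_le u).trans (by gcongr)
      · exact h u v hu hv
    · refine (hmul _ _).trans ?_
      gcongr
      · exact (norm_absPowMul_le k v).trans (by gcongr)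
      · exact (seminorm_mul_conj_self_sub_le hmul hconj u v).trans (by gcongr)

include hc hmul hconj in
theorem exists_seminorm_nonlin_sub_le (p : ℕ) (σ : ℝ) (V : Hhat1) {M : ℝ} (hM : 0 ≤ M) :
    ∃ K : ℝ, 0 ≤ K ∧ ∀ u v : Hhat1, ‖u‖ ≤ M → ‖v‖ ≤ M →
      ν (nonlin p σ V u - nonlin p σ V v) ≤ K * ν (u - v) := by
  obtain ⟨K, hK, h⟩ := exists_seminorm_absPowMul_sub_le hc hmul hconj p hM
  refine ⟨c * ‖V‖ + 2 + |σ| * K, by positivity, fun u v hu hv => ?_⟩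
  calc ν (nonlin p σ V u - nonlin p σ V v)
      ≤ ν (Hhat1.mul V (u - v)) + ν ((2 : ℂ) • (u - v)) +
          ν ((σ : ℂ) • (absPowMul p u - absPowMul p v)) := by
        rw [nonlin_sub]
        exact (map_add_le_add ν _ _).trans (add_le_add_left (map_sub_le_add ν _ _) _)
    _ ≤ c * ‖V‖ * ν (u - v) + 2 * ν (u - v) + |σ| * (K * ν (u - v)) := by
        rw [map_smul_eq_mul, map_smul_eq_mul, Complex.norm_two, Complex.norm_real,
          Real.norm_eq_abs]
        gcongr
        exacts [hmul V _, h u v hu hv]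
    _ = (c * ‖V‖ + 2 + |σ| * K) * ν (u - v) := by ring

end Seminorm

theorem exists_lipschitzOnWith_nonlin (p : ℕ) (σ : ℝ) (V : Hhat1) {M : ℝ} (hM : 0 ≤ M) :
    ∃ K : NNReal, LipschitzOnWith K (nonlin p σ V) (Metric.closedBall 0 M) := by
  obtain ⟨K, hK, h⟩ := exists_seminorm_nonlin_sub_le (ν := normSeminorm ℂ Hhat1) (c := 8)
    (by norm_num) Hhat1.norm_mul_le Hhat1.norm_conj p σ V hM
  refine ⟨⟨K, hK⟩, .of_dist_le_mul fun u hu v hv => ?_⟩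
  rw [dist_eq_norm, dist_eq_norm]
  exact h u v (mem_closedBall_zero_iff.1 hu) (mem_closedBall_zero_iff.1 hv)

theorem exists_norm_fn_nonlin_sub_le (p : ℕ) (σ : ℝ) (V : Hhat1) {M : ℝ} (hM : 0 ≤ M) :
    ∃ K : ℝ, ∀ u v : Hhat1, ‖u‖ ≤ M → ‖v‖ ≤ M →
      ‖fn (nonlin p σ V u - nonlin p σ V v)‖ ≤ K * ‖fn (u - v)‖ := by
  obtain ⟨K, -, h⟩ := exists_seminorm_nonlin_sub_le
    (ν := (normSeminorm ℂ L2).comp (fn : Hhat1 →ₗ[ℂ] L2)) (c := 2) (by norm_num)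
    (fun a b => Hhat1.mul_comm a b ▸ Hhat1.norm_fn_mul_le b a)
    (fun a => L2.norm_star (fn a)) p σ V hM
  exact ⟨K, h⟩

theorem continuous_nonlin (p : ℕ) (σ : ℝ) (V : Hhat1) : Continuous (nonlin p σ V) := by
  refine continuous_iff_continuousAt.2 fun u => ?_
  obtain ⟨K, hK⟩ := exists_lipschitzOnWith_nonlin p σ V (M := ‖u‖ + 1) (by positivity)
  exact hK.continuousOn.continuousAt <|
    Metric.closedBall_mem_nhds_of_mem (by simp [Metric.mem_ball])

/-! ### The equation in `Ĥ⁻¹` -/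

theorem integral_sq_mul_fn_mul_fn (u φ : Hhat1) : ∫ x : ℝ, (x : ℂ) ^ 2 * fn u x * fn φ x =
    (∫ x, wt u x * wt φ x) - ∫ x, fn u x * fn φ x := by
  rw [← integral_sub (integrable_mul_L2 _ _) (integrable_mul_L2 _ _)]
  refine integral_congr_ae ?_
  filter_upwards [wt_ae_eq u, wt_ae_eq φ] with x hu hφ
  have hbracket : (bracket x : ℂ) * (bracket x : ℂ) = 1 + (x : ℂ) ^ 2 := by
    rw [← Complex.ofReal_mul, bracket, Real.mul_self_sqrt (by positivity)]
    push_cast; rfl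
  rw [hu, hφ]
  linear_combination -(fn u x * fn φ x) * hbracket

theorem contDiff_one_and_deriv_eq_iff {F : Type*} [NormedAddCommGroup F] [NormedSpace ℝ F]
    {f f' : ℝ → F} (hf' : Continuous f') :
    (ContDiff ℝ 1 f ∧ deriv f = f') ↔ ∀ t, HasDerivAt f (f' t) t := by
  constructor
  · rintro ⟨hf, rfl⟩ t
    exact (hf.differentiable one_ne_zero t).hasDerivAt
  · intro h
    obtain rfl : deriv f = f' := funext fun t => (h t).deriv
    exact ⟨contDiff_one_iff_deriv.2 ⟨fun t => (h t).differentiableAt, hf'⟩, rfl⟩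

section Equation

variable {V : ℝ → ℝ} {V' : Hhat1} (hV : ∀ᵐ x : ℝ, fn V' x = (V x : ℂ))

include hV

theorem toHhatNeg1_nonlin_apply (p : ℕ) (σ : ℝ) (u φ : Hhat1) :
    toHhatNeg1 (nonlin p σ V' u) φ =
      (∫ x, (V x : ℂ) * fn u x * fn φ x) - 2 * (∫ x, fn u x * fn φ x) +
        (σ : ℂ) * ∫ x, ((‖fn u x‖ ^ (2 * p) : ℝ) : ℂ) * fn u x * fn φ x := by
  have hpotential : toHhatNeg1 (Hhat1.mul V' u) φ = ∫ x, (V x : ℂ) * fn u x * fn φ x := by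
    rw [toHhatNeg1_apply]
    refine integral_congr_ae ?_
    filter_upwards [hV, Hhat1.fn_mul_ae V' u] with x hx hmul
    rw [hmul, hx]
  have hpower : toHhatNeg1 (absPowMul p u) φ =
      ∫ x, ((‖fn u x‖ ^ (2 * p) : ℝ) : ℂ) * fn u x * fn φ x := by
    rw [toHhatNeg1_apply]
    refine integral_congr_ae ?_
    filter_upwards [fn_absPowMul_ae p u] with x hx
    rw [hx]
  rw [← hpotential, ← hpower, ← toHhatNeg1_apply, nonlin, map_add, map_sub, map_smul, map_smul]
  rfl

theorem rieszEquiv_add_gram_nonlin_apply (p : ℕ) (σ : ℝ) (u φ : Hhat1) :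
    rieszEquiv (u + gram fn (nonlin p σ V' u)) φ =
      (∫ x, dx u x * dx φ x) + (∫ x : ℝ, (x : ℂ) ^ 2 * fn u x * fn φ x) +
        (∫ x, (V x : ℂ) * fn u x * fn φ x) +
        (σ : ℂ) * ∫ x, ((‖fn u x‖ ^ (2 * p) : ℝ) : ℂ) * fn u x * fn φ x := by
  rw [map_add, ← toHhatNeg1_eq_rieszEquiv, add_apply, toHhatNeg1_nonlin_apply hV]
  change rieszMap u φ + _ = _
  rw [rieszMap_apply, integral_sq_mul_fn_mul_fn]
  ring

theorem equation_iff_eq_rieszEquiv (p : ℕ) (σ : ℝ) (u : Hhat1) (ℓ : HhatNeg1) :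
    (∀ φ, Complex.I * ℓ φ =
      (∫ x, dx u x * dx φ x) + (∫ x : ℝ, (x : ℂ) ^ 2 * fn u x * fn φ x) +
        (∫ x, (V x : ℂ) * fn u x * fn φ x) +
        (σ : ℂ) * ∫ x, ((‖fn u x‖ ^ (2 * p) : ℝ) : ℂ) * fn u x * fn φ x) ↔
      ℓ = rieszEquiv (-Complex.I • (u + gram fn (nonlin p σ V' u))) := by
  simp only [← rieszEquiv_add_gram_nonlin_apply hV, ContinuousLinearMap.ext_iff, map_smul,
    smul_apply, smul_eq_mul]
  refine forall_congr' fun φ => ?_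
  rw [neg_mul, ← mul_right_inj' Complex.I_ne_zero (a := Complex.I) (b := ℓ φ), mul_neg,
    ← mul_assoc _ _ (rieszEquiv _ _), Complex.I_mul_I, neg_one_mul, neg_neg]

theorem isGlobalSolution_iff (p : ℕ) (σ : ℝ) (u₀ : Hhat1) (u : ℝ →ᵇ Hhat1) :
    IsGlobalSolution p σ V u₀ u ↔ u 0 = u₀ ∧ SolvesEvolution (gram fn) (nonlin p σ V') u := by
  have hcont : Continuous fun t =>
      rieszEquiv (-Complex.I • (u t + gram fn (nonlin p σ V' (u t)))) :=
    rieszEquiv.continuous.comp ((u.continuous.add ((gram fn).continuous.comp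
      ((continuous_nonlin p σ V').comp u.continuous))).const_smul (-Complex.I))
  have hderiv := contDiff_one_and_deriv_eq_iff (F := HhatNeg1)
    (f := fun t => toHhatNeg1 (u t)) hcont
  constructor
  · rintro ⟨h0, hdiff, heq⟩
    have hd := hderiv.1 ⟨hdiff, funext fun t => (equation_iff_eq_rieszEquiv hV p σ _ _).1 (heq t)⟩
    exact ⟨h0, u.continuous, fun t => hasDerivAt_toHhatNeg1_iff.1 (hd t)⟩
  · rintro ⟨h0, hu⟩
    obtain ⟨hdiff, heq⟩ := hderiv.2 fun t => hasDerivAt_toHhatNeg1_iff.2 (hu.hasDerivAt t)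
    exact ⟨h0, hdiff, fun t => (equation_iff_eq_rieszEquiv hV p σ _ _).2 (congrFun heq t)⟩

end Equation

/-! ### Coercivity of the Hamiltonian -/

theorem L2.integrable_norm_sq (f : L2) : Integrable fun x => ‖f x‖ ^ 2 :=
  (Lp.memLp f).integrable_norm_pow (by norm_num)

section BoundedWeight

variable {W : ℝ → ℝ} {ρ : ℝ}

theorem integrable_mul_norm_sq (hW : AEStronglyMeasurable W volume) (hb : ∀ᵐ x : ℝ, |W x| ≤ ρ)
    (f : L2) : Integrable fun x => W x * ‖f x‖ ^ 2 :=
  f.integrable_norm_sq.bdd_mul hW hb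

theorem abs_integral_mul_norm_sq_le (hb : ∀ᵐ x : ℝ, |W x| ≤ ρ) (f : L2) :
    |∫ x, W x * ‖f x‖ ^ 2| ≤ ρ * ‖f‖ ^ 2 := by
  rw [L2.norm_sq_eq_integral, ← integral_const_mul, ← Real.norm_eq_abs]
  refine norm_integral_le_of_norm_le (f.integrable_norm_sq.const_mul _) ?_
  filter_upwards [hb] with x hx
  rw [norm_mul, Real.norm_eq_abs, norm_pow, norm_norm]
  gcongr

end BoundedWeight

theorem ae_norm_fn_pow_le (u : Hhat1) (p : ℕ) :
    ∀ᵐ x : ℝ, ‖fn u x‖ ^ (2 * p + 2) ≤ (2 * ‖u‖) ^ (2 * p) * ‖fn u x‖ ^ 2 := by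
  filter_upwards [ae_norm_fn_le u] with x hx
  rw [pow_add]
  gcongr

theorem integrable_norm_fn_pow (u : Hhat1) (p : ℕ) :
    Integrable fun x => ‖fn u x‖ ^ (2 * p + 2) := by
  refine ((fn u).integrable_norm_sq.const_mul ((2 * ‖u‖) ^ (2 * p))).mono'
    ((Lp.aestronglyMeasurable (fn u)).norm.pow _) ?_
  filter_upwards [ae_norm_fn_pow_le u p] with x hx
  rwa [norm_pow, norm_norm]

theorem integral_norm_fn_pow_le (u : Hhat1) (p : ℕ) :
    ∫ x, ‖fn u x‖ ^ (2 * p + 2) ≤ (2 * ‖u‖) ^ (2 * p) * ‖fn u‖ ^ 2 := by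
  rw [L2.norm_sq_eq_integral, ← integral_const_mul]
  exact integral_mono_ae (integrable_norm_fn_pow u p) ((fn u).integrable_norm_sq.const_mul _)
    (ae_norm_fn_pow_le u p)

theorem norm_fn_le_norm_wt (u : Hhat1) : ‖fn u‖ ≤ ‖wt u‖ := by
  refine Lp.norm_le_norm_of_ae_le ?_
  filter_upwards [wt_ae_eq u] with x hx
  have hbracket : 1 ≤ bracket x := Real.one_le_sqrt.2 (le_add_of_nonneg_right (sq_nonneg x))
  rw [hx, norm_mul, Complex.norm_real, Real.norm_of_nonneg (zero_le_one.trans hbracket)]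
  exact le_mul_of_one_le_left (norm_nonneg _) hbracket

/-- The density `(V/2 - 1) |z|² + σ/(2p+2) |z|^{2p+2}` of `potential`, at a point where the external
potential takes the value `V`. -/
def potentialDensity (p : ℕ) (σ V : ℝ) (z : ℂ) : ℝ :=
  (V / 2 - 1) * ‖z‖ ^ 2 + σ / (2 * p + 2) * ‖z‖ ^ (2 * p + 2)

/-- The difference between the Hamiltonian `energy p σ V u` and the quadratic form `‖u‖² / 2`, which
is the Hamiltonian of `-∂ₓₓ + x² + 2`. -/
def potential (p : ℕ) (σ : ℝ) (V : ℝ → ℝ) (u : Hhat1) : ℝ :=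
  ∫ x, potentialDensity p σ (V x) (fn u x)

theorem integral_quadratic_eq {W : ℝ → ℝ} {u : Hhat1}
    (hW : Integrable fun x => W x * ‖fn u x‖ ^ 2) :
    ∫ x, (‖dx u x‖ ^ 2 + x ^ 2 * ‖fn u x‖ ^ 2 + W x * ‖fn u x‖ ^ 2) =
      ‖dx u‖ ^ 2 + (‖wt u‖ ^ 2 - ‖fn u‖ ^ 2) + ∫ x, W x * ‖fn u x‖ ^ 2 := by
  have hsq : (fun x => ‖wt u x‖ ^ 2 - ‖fn u x‖ ^ 2) =ᵐ[volume] fun x => x ^ 2 * ‖fn u x‖ ^ 2 := by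
    filter_upwards [wt_ae_eq u] with x hx
    have hbracket : bracket x ^ 2 = 1 + x ^ 2 := Real.sq_sqrt (by positivity)
    rw [hx, norm_mul, mul_pow, Complex.norm_real, Real.norm_eq_abs, sq_abs, hbracket]
    ring
  have hdx := (dx u).integrable_norm_sq
  have hx : Integrable fun x => x ^ 2 * ‖fn u x‖ ^ 2 :=
    ((wt u).integrable_norm_sq.sub (fn u).integrable_norm_sq).congr hsq
  have hdx_add_hx : Integrable fun x => ‖dx u x‖ ^ 2 + x ^ 2 * ‖fn u x‖ ^ 2 := hdx.add hx
  rw [integral_add hdx_add_hx hW, integral_add hdx hx, ← integral_congr_ae hsq,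
    integral_sub (wt u).integrable_norm_sq (fn u).integrable_norm_sq,
    L2.norm_sq_eq_integral, L2.norm_sq_eq_integral, L2.norm_sq_eq_integral]

section BoundedPotential

variable {W : ℝ → ℝ} (hW : AEStronglyMeasurable W volume) {ρ : ℝ} (hb : ∀ᵐ x : ℝ, |W x| ≤ ρ)
  (p : ℕ) (σ : ℝ) (u : Hhat1)

include hW hb

theorem integrable_half_sub_one_mul_norm_sq : Integrable fun x => (W x / 2 - 1) * ‖fn u x‖ ^ 2 := by
  refine (((integrable_mul_norm_sq hW hb (fn u)).const_mul (1 / 2)).sub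
    (fn u).integrable_norm_sq).congr (.of_forall fun x => ?_)
  change 1 / 2 * (W x * ‖fn u x‖ ^ 2) - ‖fn u x‖ ^ 2 = _
  ring

theorem integrable_potentialDensity : Integrable fun x => potentialDensity p σ (W x) (fn u x) :=
  (integrable_half_sub_one_mul_norm_sq hW hb u).add ((integrable_norm_fn_pow u p).const_mul _)

theorem potential_eq : potential p σ W u =
    1 / 2 * (∫ x, W x * ‖fn u x‖ ^ 2) - ‖fn u‖ ^ 2 +
      σ / (2 * p + 2) * ∫ x, ‖fn u x‖ ^ (2 * p + 2) := by
  have hquad : ∫ x, (W x / 2 - 1) * ‖fn u x‖ ^ 2 =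
      1 / 2 * (∫ x, W x * ‖fn u x‖ ^ 2) - ‖fn u‖ ^ 2 := by
    rw [L2.norm_sq_eq_integral, ← integral_const_mul,
      ← integral_sub ((integrable_mul_norm_sq hW hb (fn u)).const_mul _) (fn u).integrable_norm_sq]
    congr! 2
    ring
  rw [← hquad, ← integral_const_mul]
  exact integral_add (integrable_half_sub_one_mul_norm_sq hW hb u)
    ((integrable_norm_fn_pow u p).const_mul _)

theorem energy_eq_potential : energy p σ W u = 1 / 2 * ‖u‖ ^ 2 + potential p σ W u := by
  rw [energy, potential_eq hW hb, Hhat1.norm_sq_eq,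
    integral_quadratic_eq (integrable_mul_norm_sq hW hb (fn u))]
  ring

omit hW in
theorem quadratic_coercive {κ : ℝ} (hκ : 4 * κ ≤ 1) (hκρ : 8 * κ ≤ ρ) (hρ : 0 ≤ ρ) :
    2 * κ * ‖u‖ ^ 2 ≤
        1 / 2 * ‖u‖ ^ 2 + (1 / 2 * (∫ x, W x * ‖fn u x‖ ^ 2) - ‖fn u‖ ^ 2) + ρ * ‖fn u‖ ^ 2 ∧
      1 / 2 * ‖u‖ ^ 2 + (1 / 2 * (∫ x, W x * ‖fn u x‖ ^ 2) - ‖fn u‖ ^ 2) + ρ * ‖fn u‖ ^ 2 ≤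
        (1 / 2 + 2 * ρ) * ‖u‖ ^ 2 := by
  obtain ⟨hlower, hupper⟩ := abs_le.1 (abs_integral_mul_norm_sq_le hb (fn u))
  have hwt : 0 ≤ ‖wt u‖ ^ 2 - ‖fn u‖ ^ 2 := sub_nonneg.2 (by gcongr; exact norm_fn_le_norm_wt u)
  have hfn := sq_nonneg ‖fn u‖
  have hdx := sq_nonneg ‖dx u‖
  rw [Hhat1.norm_sq_eq]
  constructor
  · nlinarith [mul_nonneg (sub_nonneg.2 hκ) hdx, mul_nonneg (sub_nonneg.2 hκ) hwt,
      mul_nonneg (sub_nonneg.2 hκρ) hfn]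
  · nlinarith [mul_nonneg hρ hfn, mul_nonneg hρ hdx, mul_nonneg hρ hwt]

end BoundedPotential

theorem abs_mul_integral_norm_fn_pow_le (p : ℕ) (σ : ℝ) (u : Hhat1) :
    |σ / (2 * p + 2) * ∫ x, ‖fn u x‖ ^ (2 * p + 2)| ≤ |σ| * (2 * ‖u‖) ^ (2 * p) * ‖u‖ ^ 2 := by
  have hnonneg : 0 ≤ ∫ x, ‖fn u x‖ ^ (2 * p + 2) := integral_nonneg fun x => by positivity
  have hp : (1 : ℝ) ≤ 2 * p + 2 := by linarith [p.cast_nonneg (α := ℝ)]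
  rw [abs_mul, abs_div, abs_of_nonneg hnonneg, abs_of_pos (zero_lt_one.trans_le hp), mul_assoc]
  gcongr
  · exact div_le_self (abs_nonneg σ) hp
  · exact (integral_norm_fn_pow_le u p).trans (by gcongr; exact norm_fn_le u)

theorem exists_energy_coercive {p : ℕ} (hp : 1 ≤ p) (σ : ℝ) {ρ : ℝ} (hρ : 0 < ρ) :
    ∃ C > (0 : ℝ), ∃ r > (0 : ℝ), ∀ W : ℝ → ℝ, AEStronglyMeasurable W volume →
      (∀ᵐ x : ℝ, |W x| ≤ ρ) → ∀ w : Hhat1, ‖w‖ ≤ r →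
        C⁻¹ * ‖w‖ ^ 2 ≤ energy p σ W w + ρ * ‖fn w‖ ^ 2 ∧
        energy p σ W w + ρ * ‖fn w‖ ^ 2 ≤ C * ‖w‖ ^ 2 := by
  obtain ⟨κ, hκ, hκ_lt⟩ := exists_between (show 0 < min (1 / 4) (ρ / 8) by positivity)
  obtain ⟨hκ₁, hκρ⟩ := lt_min_iff.1 hκ_lt
  refine ⟨max κ⁻¹ (1 + 2 * ρ), by positivity, κ / (2 * (1 + |σ|)), by positivity,
    fun W hW hb w hw => ?_⟩
  rw [le_div_iff₀ (by positivity)] at hw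
  have hσw := mul_nonneg (abs_nonneg σ) (norm_nonneg w)
  have hpow : (2 * ‖w‖) ^ (2 * p) ≤ 2 * ‖w‖ :=
    pow_le_of_le_one (by positivity) (by linarith) (by lia)
  have hsmall : |σ| * (2 * ‖w‖) ^ (2 * p) ≤ κ := calc
    |σ| * (2 * ‖w‖) ^ (2 * p) ≤ |σ| * (2 * ‖w‖) := by gcongr
    _ ≤ κ := by linarith [norm_nonneg w]
  have hpower : |σ / (2 * p + 2) * ∫ x, ‖fn w x‖ ^ (2 * p + 2)| ≤ κ * ‖w‖ ^ 2 :=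
    (abs_mul_integral_norm_fn_pow_le p σ w).trans (by gcongr)
  obtain ⟨hpower_lower, hpower_upper⟩ := abs_le.1 hpower
  obtain ⟨hquad_lower, hquad_upper⟩ :=
    quadratic_coercive hb w (κ := κ) (by linarith) (by linarith) hρ.le
  rw [energy_eq_potential hW hb, potential_eq hW hb]
  constructor
  · have hinv : (max κ⁻¹ (1 + 2 * ρ))⁻¹ * ‖w‖ ^ 2 ≤ κ * ‖w‖ ^ 2 := by
      gcongr
      exact inv_le_of_inv_le₀ hκ (le_max_left _ _)
    linarith
  · have hmax : (1 + 2 * ρ) * ‖w‖ ^ 2 ≤ max κ⁻¹ (1 + 2 * ρ) * ‖w‖ ^ 2 := by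
      gcongr
      exact le_max_right _ _
    nlinarith [sq_nonneg ‖w‖]

/-! ### The nonlinearity as the gradient of the potential energy -/

theorem exists_abs_pow_sub_sub_le (q : ℕ) (S : ℝ) :
    ∃ K : ℝ, ∀ r s : ℝ, |r| ≤ S → |s| ≤ S →
      |r ^ (q + 1) - s ^ (q + 1) - (q + 1) * s ^ q * (r - s)| ≤ K * |r - s| ^ 2 := by
  induction q with
  | zero => exact ⟨0, fun r s _ _ => by simp⟩
  | succ q ih =>
    obtain ⟨K, h⟩ := ih
    refine ⟨S * K + (q + 1 : ℕ) * S ^ q, fun r s hr hs => ?_⟩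
    have hS : 0 ≤ S := (abs_nonneg r).trans hr
    have hfirst : |r ^ (q + 1) - s ^ (q + 1)| ≤ |r - s| * (q + 1 : ℕ) * S ^ q :=
      (abs_pow_sub_pow_le r s (q + 1)).trans <| by
        rw [Nat.add_sub_cancel]
        gcongr
        exact max_le hr hs
    calc |r ^ (q + 1 + 1) - s ^ (q + 1 + 1) - ((q + 1 : ℕ) + 1) * s ^ (q + 1) * (r - s)|
        = |s * (r ^ (q + 1) - s ^ (q + 1) - (q + 1) * s ^ q * (r - s)) +
            (r - s) * (r ^ (q + 1) - s ^ (q + 1))| := by push_cast; ring_nf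
      _ ≤ S * (K * |r - s| ^ 2) + |r - s| * (|r - s| * (q + 1 : ℕ) * S ^ q) := by
          refine (abs_add_le _ _).trans ?_
          rw [abs_mul, abs_mul]
          gcongr
          exact h r s hr hs
      _ = (S * K + (q + 1 : ℕ) * S ^ q) * |r - s| ^ 2 := by ring

theorem norm_sq_sub_norm_sq {E : Type*} [NormedAddCommGroup E] [InnerProductSpace ℂ E] (a b : E) :
    ‖b‖ ^ 2 - ‖a‖ ^ 2 = 2 * (inner ℂ a (b - a)).re + ‖b - a‖ ^ 2 := by
  have h := norm_add_sq (𝕜 := ℂ) a (b - a)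
  rw [add_sub_cancel, RCLike.re_eq_complex_re] at h
  linarith

theorem exists_abs_norm_pow_sub_sub_le {E : Type*} [NormedAddCommGroup E] [InnerProductSpace ℂ E]
    (q : ℕ) (M : ℝ) :
    ∃ K : ℝ, ∀ a b : E, ‖a‖ ≤ M → ‖b‖ ≤ M →
      |‖b‖ ^ (2 * q + 2) - ‖a‖ ^ (2 * q + 2) -
        (2 * q + 2) * ‖a‖ ^ (2 * q) * (inner ℂ a (b - a)).re| ≤ K * ‖b - a‖ ^ 2 := by
  obtain ⟨K, h⟩ := exists_abs_pow_sub_sub_le q (M ^ 2)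
  refine ⟨|K| * (2 * M) ^ 2 + (q + 1) * (M ^ 2) ^ q, fun a b ha hb => ?_⟩
  have hM : 0 ≤ M := (norm_nonneg a).trans ha
  have htaylor := h (‖b‖ ^ 2) (‖a‖ ^ 2) (by rw [abs_sq]; gcongr) (by rw [abs_sq]; gcongr)
  have hsq : |‖b‖ ^ 2 - ‖a‖ ^ 2| ≤ 2 * M * ‖b - a‖ := by
    rw [sq_sub_sq, abs_mul, abs_of_nonneg (by positivity), two_mul]
    gcongr
    exact abs_norm_sub_norm_le b a
  calc |‖b‖ ^ (2 * q + 2) - ‖a‖ ^ (2 * q + 2) -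
        (2 * q + 2) * ‖a‖ ^ (2 * q) * (inner ℂ a (b - a)).re|
      = |((‖b‖ ^ 2) ^ (q + 1) - (‖a‖ ^ 2) ^ (q + 1) -
          (q + 1) * (‖a‖ ^ 2) ^ q * (‖b‖ ^ 2 - ‖a‖ ^ 2)) +
          (q + 1) * (‖a‖ ^ 2) ^ q * ‖b - a‖ ^ 2| := by
        rw [norm_sq_sub_norm_sq, ← pow_mul, ← pow_mul, ← pow_mul]
        ring_nf
    _ ≤ |K| * (2 * M * ‖b - a‖) ^ 2 + (q + 1) * (M ^ 2) ^ q * ‖b - a‖ ^ 2 := by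
        refine (abs_add_le _ _).trans (add_le_add (htaylor.trans ?_) ?_)
        · gcongr
          exact le_abs_self K
        · rw [abs_of_nonneg (by positivity)]
          gcongr
    _ = (|K| * (2 * M) ^ 2 + (q + 1) * (M ^ 2) ^ q) * ‖b - a‖ ^ 2 := by ring

theorem exists_abs_potentialDensity_sub_sub_le (p : ℕ) (σ M : ℝ) :
    ∃ K : ℝ, ∀ (V : ℝ) (a b : ℂ), ‖a‖ ≤ M → ‖b‖ ≤ M →
      |potentialDensity p σ V b - potentialDensity p σ V a -
          (inner ℂ (((V : ℂ) - 2 + σ * ((‖a‖ ^ (2 * p) : ℝ) : ℂ)) * a) (b - a)).re| ≤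
        (|V / 2 - 1| + K) * ‖b - a‖ ^ 2 := by
  obtain ⟨K, h⟩ := exists_abs_norm_pow_sub_sub_le (E := ℂ) p M
  refine ⟨|σ / (2 * p + 2)| * K, fun V a b ha hb => ?_⟩
  have hcoeff : (V : ℂ) - 2 + σ * ((‖a‖ ^ (2 * p) : ℝ) : ℂ) =
      ((V - 2 + σ * ‖a‖ ^ (2 * p) : ℝ) : ℂ) := by push_cast; rfl
  have hinner : (inner ℂ (((V : ℂ) - 2 + σ * ((‖a‖ ^ (2 * p) : ℝ) : ℂ)) * a) (b - a)).re =
      (V - 2 + σ * ‖a‖ ^ (2 * p)) * (inner ℂ a (b - a)).re := by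
    rw [hcoeff, ← smul_eq_mul, inner_smul_left, Complex.conj_ofReal, Complex.re_ofReal_mul]
  have hdiff : potentialDensity p σ V b - potentialDensity p σ V a -
      (V - 2 + σ * ‖a‖ ^ (2 * p)) * (inner ℂ a (b - a)).re =
      (V / 2 - 1) * ‖b - a‖ ^ 2 + σ / (2 * p + 2) * (‖b‖ ^ (2 * p + 2) - ‖a‖ ^ (2 * p + 2) -
        (2 * p + 2) * ‖a‖ ^ (2 * p) * (inner ℂ a (b - a)).re) := by
    have hcancel : σ / (2 * p + 2) * (2 * p + 2) = σ := div_mul_cancel₀ σ (by positivity)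
    simp only [potentialDensity]
    linear_combination (V / 2 - 1) * norm_sq_sub_norm_sq a b +
      ‖a‖ ^ (2 * p) * (inner ℂ a (b - a)).re * hcancel
  rw [hinner, hdiff, add_mul (|V / 2 - 1|), mul_assoc |_|]
  refine (abs_add_le _ _).trans ?_
  rw [abs_mul, abs_mul, abs_sq]
  gcongr
  exact h a b ha hb

section RealPotential

variable {V : ℝ → ℝ} {V' : Hhat1} (hV : ∀ᵐ x : ℝ, fn V' x = (V x : ℂ))

include hV

theorem aestronglyMeasurable_of_fn_ae_eq : AEStronglyMeasurable V volume := by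
  refine (Complex.continuous_re.comp_aestronglyMeasurable
    (Lp.aestronglyMeasurable (fn V'))).congr ?_
  filter_upwards [hV] with x hx
  rw [hx, Complex.ofReal_re]

theorem ae_abs_le_of_fn_ae_eq : ∀ᵐ x : ℝ, |V x| ≤ 2 * ‖V'‖ := by
  filter_upwards [hV, ae_norm_fn_le V'] with x hx hle
  rwa [hx, Complex.norm_real, Real.norm_eq_abs] at hle

theorem im_inner_fn_nonlin (p : ℕ) (σ : ℝ) (u : Hhat1) :
    (inner ℂ (fn u) (fn (nonlin p σ V' u))).im = 0 := by
  have hreal : inner ℂ (fn u) (fn (nonlin p σ V' u)) =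
      ∫ x, (((V x - 2 + σ * ‖fn u x‖ ^ (2 * p)) * ‖fn u x‖ ^ 2 : ℝ) : ℂ) := by
    rw [MeasureTheory.L2.inner_def]
    refine integral_congr_ae ?_
    filter_upwards [hV, fn_nonlin_ae p σ V' u] with x hx hnonlin
    rw [hnonlin, hx, RCLike.inner_apply, mul_assoc, Complex.mul_conj']
    push_cast
    ring
  rw [hreal, integral_complex_ofReal, Complex.ofReal_im]

theorem exists_abs_potential_sub_sub_le (p : ℕ) (σ M : ℝ) :
    ∃ K : ℝ, ∀ a b : Hhat1, ‖a‖ ≤ M → ‖b‖ ≤ M →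
      |potential p σ V b - potential p σ V a -
        (inner ℂ (fn (nonlin p σ V' a)) (fn (b - a))).re| ≤ K * ‖fn (b - a)‖ ^ 2 := by
  obtain ⟨K, hK⟩ := exists_abs_potentialDensity_sub_sub_le p σ (2 * M)
  refine ⟨‖V'‖ + 1 + K, fun a b ha hb => ?_⟩
  have hint : ∀ u : Hhat1, Integrable fun x => potentialDensity p σ (V x) (fn u x) :=
    integrable_potentialDensity (aestronglyMeasurable_of_fn_ae_eq hV) (ae_abs_le_of_fn_ae_eq hV) p σ
  have hint_sub : Integrable fun x =>
      potentialDensity p σ (V x) (fn b x) - potentialDensity p σ (V x) (fn a x) :=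
    (hint b).sub (hint a)
  have hint_inner : Integrable fun x => inner ℂ (fn (nonlin p σ V' a) x) (fn (b - a) x) :=
    MeasureTheory.L2.integrable_inner _ _
  have hint_re : Integrable fun x => (inner ℂ (fn (nonlin p σ V' a) x) (fn (b - a) x)).re :=
    hint_inner.re
  have hinner : (inner ℂ (fn (nonlin p σ V' a)) (fn (b - a))).re =
      ∫ x, (inner ℂ (fn (nonlin p σ V' a) x) (fn (b - a) x)).re := by
    rw [MeasureTheory.L2.inner_def]
    exact (integral_re hint_inner).symm
  rw [hinner, potential, potential, ← integral_sub (hint b) (hint a),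
    ← integral_sub hint_sub hint_re, L2.norm_sq_eq_integral, ← integral_const_mul,
    ← Real.norm_eq_abs]
  refine norm_integral_le_of_norm_le ((fn (b - a)).integrable_norm_sq.const_mul _) ?_
  filter_upwards [hV, ae_abs_le_of_fn_ae_eq hV, fn_nonlin_ae p σ V' a, fn_sub_ae b a,
    ae_norm_fn_le a, ae_norm_fn_le b] with x hx hVx hnonlin hsub hax hbx
  rw [hnonlin, hsub, hx]
  refine (hK (V x) _ _ (hax.trans (by gcongr)) (hbx.trans (by gcongr))).trans ?_
  gcongr
  obtain ⟨hlower, hupper⟩ := abs_le.1 hVx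
  exact abs_le.2 ⟨by linarith, by linarith⟩

theorem potential_sub_sub_isBigO (p : ℕ) (σ : ℝ) (a : Hhat1) :
    (fun b => potential p σ V b - potential p σ V a -
      (inner ℂ (fn (nonlin p σ V' a)) (fn (b - a))).re) =O[nhds a]
      fun b => ‖fn (b - a)‖ ^ 2 := by
  obtain ⟨K, hK⟩ := exists_abs_potential_sub_sub_le hV p σ (‖a‖ + 1)
  refine .of_bound K ?_
  filter_upwards [continuous_norm.continuousAt.eventually_le_const (lt_add_one ‖a‖)] with b hb
  rw [norm_pow, norm_norm]
  exact hK a b (by linarith) hb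

end RealPotential

/-! ### Global well-posedness -/

section WellPosedness

variable {p : ℕ} {σ : ℝ} {V : ℝ → ℝ} {V' : Hhat1} (hV : ∀ᵐ x : ℝ, fn V' x = (V x : ℂ)) {u₀ : Hhat1}

include hV

theorem IsGlobalSolution.eq {u v : ℝ →ᵇ Hhat1} (hu : IsGlobalSolution p σ V u₀ u)
    (hv : IsGlobalSolution p σ V u₀ v) : u = v := by
  obtain ⟨hu₀, hu⟩ := (isGlobalSolution_iff hV p σ u₀ u).1 hu
  obtain ⟨hv₀, hv⟩ := (isGlobalSolution_iff hV p σ u₀ v).1 hv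
  obtain ⟨K, hK⟩ := exists_norm_fn_nonlin_sub_le p σ V' (M := max ‖u‖ ‖v‖) (by positivity)
  exact DFunLike.coe_injective <| hu.eq_of_norm_apply_sub_le fn_injective hv
    (fun t => hK _ _ ((u.norm_coe_le_norm t).trans (le_max_left _ _))
      ((v.norm_coe_le_norm t).trans (le_max_right _ _))) (hu₀.trans hv₀.symm)

theorem exists_isGlobalSolution {R C κ : ℝ} (hR : 0 < R) (hC : 0 < C)
    (hco : ∀ w : Hhat1, ‖w‖ ≤ R → C⁻¹ * ‖w‖ ^ 2 ≤ energy p σ V w + κ * ‖fn w‖ ^ 2 ∧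
      energy p σ V w + κ * ‖fn w‖ ^ 2 ≤ C * ‖w‖ ^ 2)
    (hu₀ : ‖u₀‖ ≤ R) (hCu₀ : C * ‖u₀‖ < R) :
    ∃ u : ℝ →ᵇ Hhat1, IsGlobalSolution p σ V u₀ u ∧ ∀ t, ‖u t‖ ≤ C * ‖u₀‖ := by
  obtain ⟨K, hK⟩ := exists_lipschitzOnWith_nonlin p σ V' hR.le
  simp only [energy_eq_potential (aestronglyMeasurable_of_fn_ae_eq hV)
    (ae_abs_le_of_fn_ae_eq hV)] at hco
  obtain ⟨u, hu, hu_zero, hu_le⟩ := exists_solvesEvolution_of_coercive fn_injective hR hC hK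
    (im_inner_fn_nonlin hV p σ) (potential_sub_sub_isBigO hV p σ) hco hu₀ hCu₀
  exact ⟨.ofNormedAddCommGroup u hu.continuous (C * ‖u₀‖) hu_le,
    (isGlobalSolution_iff hV p σ u₀ _).2 ⟨hu_zero, hu⟩, hu_le⟩

end WellPosedness

theorem inv_mul_le_and_le_mul_of_le {C D : ℝ} (hC : 0 < C) (hCD : C ≤ D) {N E : ℝ} (hN : 0 ≤ N)
    (h : C⁻¹ * N ≤ E ∧ E ≤ C * N) : D⁻¹ * N ≤ E ∧ E ≤ D * N :=
  ⟨(mul_le_mul_of_nonneg_right (inv_anti₀ hC hCD) hN).trans h.1,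
    h.2.trans (mul_le_mul_of_nonneg_right hCD hN)⟩

end HarmonicNLS

end

theorem theorem5p3_general (p : ℕ) (hp : 1 ≤ p) (σ : ℝ) (ρ : ℝ) (hρ : 0 < ρ) :
    ∃ ε > (0 : ℝ), ∃ C > (0 : ℝ),
      (∀ W : ℝ → ℝ, AEStronglyMeasurable W volume → (∀ᵐ x : ℝ, |W x| ≤ ρ) →
        ∀ w : HarmonicNLS.Hhat1, ‖w‖ ≤ C * ε →
          C⁻¹ * ‖w‖ ^ 2 ≤ HarmonicNLS.energy p σ W w + ρ * ‖HarmonicNLS.fn w‖ ^ 2 ∧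
          HarmonicNLS.energy p σ W w + ρ * ‖HarmonicNLS.fn w‖ ^ 2 ≤ C * ‖w‖ ^ 2) ∧
      (∀ (V : ℝ → ℝ) (V' : HarmonicNLS.Hhat1), (∀ᵐ x : ℝ, HarmonicNLS.fn V' x = (V x : ℂ)) →
        ‖V'‖ ≤ ρ → ∀ u₀ : HarmonicNLS.Hhat1, ‖u₀‖ ≤ ε →
          ∃ u : ℝ →ᵇ HarmonicNLS.Hhat1,
            HarmonicNLS.IsGlobalSolution p σ V u₀ u ∧
            (∀ t : ℝ, ‖u t‖ ≤ C * ‖u₀‖) ∧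
            ∀ v : ℝ →ᵇ HarmonicNLS.Hhat1, HarmonicNLS.IsGlobalSolution p σ V u₀ v → v = u) := by
  open HarmonicNLS in
  obtain ⟨C₁, hC₁, r₁, hr₁, hco₁⟩ := exists_energy_coercive hp σ hρ
  -- `‖V'‖ ≤ ρ` in `Ĥ¹` only gives `|V| ≤ 2ρ` almost everywhere.
  obtain ⟨C₂, hC₂, r₂, hr₂, hco₂⟩ := exists_energy_coercive hp σ (ρ := 2 * ρ) (by positivity)
  obtain ⟨C, hC, hC₁C, hC₂C⟩ : ∃ C, 1 ≤ C ∧ C₁ ≤ C ∧ C₂ ≤ C :=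
    ⟨max 1 (max C₁ C₂), by simp⟩
  obtain ⟨ε, hε, hCε₁, hCε₂⟩ : ∃ ε > 0, C * ε ≤ r₁ ∧ C * ε < r₂ := by
    obtain ⟨s, hs, hs_lt⟩ := exists_between (lt_min hr₁ hr₂)
    refine ⟨s / C, by positivity, ?_⟩
    rw [mul_div_cancel₀ s (by positivity)]
    exact ⟨(lt_min_iff.1 hs_lt).1.le, (lt_min_iff.1 hs_lt).2⟩
  refine ⟨ε, hε, C, by positivity, fun W hW hb w hw =>
    inv_mul_le_and_le_mul_of_le hC₁ hC₁C (sq_nonneg _) (hco₁ W hW hb w (hw.trans hCε₁)),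
    fun V V' hV hV' u₀ hu₀ => ?_⟩
  have hVρ : ∀ᵐ x : ℝ, |V x| ≤ 2 * ρ :=
    (ae_abs_le_of_fn_ae_eq hV).mono fun x hx => hx.trans (by gcongr)
  have hCu₀ : C * ‖u₀‖ < r₂ := (mul_le_mul_of_nonneg_left hu₀ (by positivity)).trans_lt hCε₂
  obtain ⟨u, hu, hu_le⟩ := exists_isGlobalSolution hV hr₂ (by positivity) (fun w hw =>
    inv_mul_le_and_le_mul_of_le hC₂ hC₂C (sq_nonneg _)
      (hco₂ V (aestronglyMeasurable_of_fn_ae_eq hV) hVρ w hw))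
    ((le_mul_of_one_le_left (norm_nonneg u₀) hC).trans hCu₀.le) hCu₀
  exact ⟨u, hu, hu_le, fun v hv => hv.eq hV hu⟩

theorem theorem5p3 (p : ℕ) (hp : 1 ≤ p) (σ : ℝ) (hσ : σ = 1 ∨ σ = -1)
    (ρ : ℝ) (hρ : 0 < ρ) :
    ∃ ε > (0 : ℝ), ∃ C > (0 : ℝ),
      -- `ε` and `C` are constants for which the Hamiltonian is coercive
      (∀ W : ℝ → ℝ, AEStronglyMeasurable W volume → (∀ᵐ x : ℝ, |W x| ≤ ρ) →
        ∀ w : HarmonicNLS.Hhat1, ‖w‖ ≤ C * ε →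
          C⁻¹ * ‖w‖ ^ 2 ≤ HarmonicNLS.energy p σ W w + ρ * ‖HarmonicNLS.fn w‖ ^ 2 ∧
          HarmonicNLS.energy p σ W w + ρ * ‖HarmonicNLS.fn w‖ ^ 2 ≤ C * ‖w‖ ^ 2) ∧
      -- global well-posedness, for every real-valued `V ∈ Ĥ¹` with norm at most `ρ`
      (∀ (V : ℝ → ℝ) (V' : HarmonicNLS.Hhat1), (∀ᵐ x : ℝ, HarmonicNLS.fn V' x = (V x : ℂ)) → ‖V'‖ ≤ ρ →
        ∀ u₀ : HarmonicNLS.Hhat1, ‖u₀‖ ≤ ε →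
          ∃ u : ℝ →ᵇ HarmonicNLS.Hhat1,
            HarmonicNLS.IsGlobalSolution p σ V u₀ u ∧
            (∀ t : ℝ, ‖u t‖ ≤ C * ‖u₀‖) ∧
            ∀ v : ℝ →ᵇ HarmonicNLS.Hhat1, HarmonicNLS.IsGlobalSolution p σ V u₀ v → v = u) :=
  theorem5p3_general p hp σ ρ hρ
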